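/- **Setting.** Let $D\subseteq\mathbb R^d$ be open and connected with boundary $S=\partial D$ (carrying the surface measure), $T=[t_0,t_f]$ with $t_0<t_f$, and write $\langle\cdot,\cdot\rangle$, $\langle\cdot,\cdot\rangle_S$ for the inner products of $L_2(D)$, $L_2(S)$. The state takes values in $\mathbb R^n$, the distributed control $U_d(t)\in L_2^k(D)$, the boundary control $U_b(t)\in L_2^l(S)$; $U=(U_d,U_b)$ is the stacked control, an element of $L_2^{k+l}(T)$, whose inner product is $\langle U,W\rangle_T=\int_{t_0}^{t_f}\big(\langle U_d,W_d\rangle+\langle U_b,W_b\rangle_S\big)dt$. Consider $$\partial_tX=F(t,X,U_d)\ \text{in }D,\qquad 0=N(t,X,U_b)\ \text{on }S,\qquad X(t_0)=X_0,$$ where $F=\sum_i\partial_i a_i(t,X)+f(t,X,U_d)$ and $N=\sum_i\nu_i a_i(t,X)+g(t,X,U_b)$ ($\nu$ the outer normal; $a_i,f,g$ possibly nonlinear and nonlocal, and possibly depending on $\nabla X$ and on the trace of $X$); on a (possibly empty) measurable part $\Gamma$ of $S$ the condition $X=0$ is imposed instead. Let $H^1$ be the space of fields with square integrable gradient and trace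 that vanish on $\Gamma$ (the $L_2$-closure of the triples (value, gradient, boundary value) of smooth compactly supported functions, cut down to zero trace on $\Gamma$). All equations are understood weakly: solutions lie in $\mathcal W=C(T;L_2^n(D))\cap L_2(T;H^1)$ with time derivative in $L_2(T;(H^1)')$, and for test fields $P\in H^1$ the pair $(F,N)$ acts by $-\sum_i\langle a_i,\partial_iP\rangle+\langle f,P\rangle-\langle g,P\rangle_S$. The cost is $$J(U)=\phi(t_f,X(t_f))+\int_{t_0}^{t_f}L(t,X,U_d,U_b)\,dt ,$$ $X$ being the state with control $U$. **Assumptions.** (1) The PDE is well posed in the sense of Hadamard: for all $X_0$ and all $U\in L_2^{k+l}(T)$ there is a unique weak solution, depending continuously (in $\mathcal W$) on $(X_0,U)$. Let $\bar U\in L_2^{k+l}(T)$ be a nominal control with state $\bar X$. (2) $a,f,g$ are Gateaux differentiable along $(\bar X,\bar U)$ for almost every $t$, with derivatives forming $F_X,F_{U_d},N_X,N_{U_b}$; $L$ and $\phi$ have Gateaux gradients everywhere and second Gateaux derivatives along $(\bar X,\bar U)$. $L$ has no cross terms there: $L_{U_dX},L_{XU_d},L_{U_bX},L_{XU_b},L_{U_dU_b},L_{U_bU_d}$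 vanish. $L_X,L_{U_d},L_{U_b}$ are square integrable over $T$. $L_{U_dU_d}(t),L_{U_bU_b}(t)$ are strongly measurable in $t$, symmetric, and bounded and positive definite uniformly in $t\in T$. (3) The linear variation system with $F_X,N_X$ is well posed: for every initial value in $L_2^n(D)$ and every forcing in $L_2(T;(H^1)')$ a weak solution exists, and its norm in $\mathcal W$ is bounded by a constant times the norms of these data. (4) For the update $\delta U$ below, the first order expansions at $(\bar X,\bar U)$ of $(F,N)$ (in $L_2(T;(H^1)')$), of $\int_T L\,dt$ and of $\phi$ have second order remainders: for state variations $h\in\mathcal W$ and control variations $\gamma\,\delta U$, both small, the remainders are $O((\|h\|_{\mathcal W}+|\gamma|)^2)$, and $L$ is integrable along $(\bar X+h,\bar U+\gamma\,\delta U)$; for $\phi$ the remainder is $O(\|h(t_f)\|^2)$. **STDDP update.** Put $Q_U=(Q_{U_d},Q_{U_b})$ with $$Q_{U_d}=L_{U_d}+F_{U_d}^\top V_X,\quad Q_{U_b}=L_{U_b}-N_{U_b}^\top V_X|_S,\quad Q_{U_dX}=F_{U_d}^\top V_{XX},\quad Q_{U_bX}=-N_{U_b}^\top V_{XX}|_S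 .$$ Here $V_X$, and $V_{XX}$ (symmetric; bounded on $L_2^n(D)$ for each $t$ and acting boundedly on $H^1$ for almost every $t$), are weak solutions of the backward value equations along the nominal trajectory: $$-\tfrac{d}{dt}V_X=L_X+F_X^*V_X-\sum_{c\in\{d,b\}}Q_{U_cX}^\top L_{U_cU_c}^{-1}Q_{U_c},\quad N_X^*V_X=0\text{ on }S,\quad V_X(t_f)=\phi_X,$$ $$-\tfrac{d}{dt}V_{XX}=L_{XX}+F_X^*V_{XX}+[F_X^*V_{XX}]^\top-\sum_{c\in\{d,b\}}Q_{U_cX}^\top L_{U_cU_c}^{-1}Q_{U_cX},\quad N_X^*V_{XX}=0\text{ on }S,\quad V_{XX}(t_f)=\phi_{XX}.$$ The update $\delta U=(\delta U_d,\delta U_b)$ is $$\delta U_d=-L_{U_dU_d}^{-1}\big(Q_{U_d}+Q_{U_dX}\,\delta X\big),\qquad \delta U_b=-L_{U_bU_b}^{-1}\big(Q_{U_b}+Q_{U_bX}\,\delta X\big),$$ where $\delta X$ solves the variation dynamics driven by it: $$\tfrac{d}{dt}\delta X=F_X\delta X+F_{U_d}\delta U_d\ \text{in }D,\qquad 0=N_X\delta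 X+N_{U_b}\delta U_b\ \text{on }S,\qquad \delta X(t_0)=0 .$$ Assume $\delta U,\,Q_U\in L_2^{k+l}(T)$. The control update with step size $\gamma$ is $\bar U\mapsto\bar U+\gamma\,\delta U$, and correspondingly $dU/di=\gamma\,\delta U$ for a continuous iteration index $i$. **Theorem.** There is a bounded operator $M$ on $L_2^{k+l}(T)$, independent of $\gamma$, acting at each time $t$ by an operator $M(t)$ that is symmetric and positive definite for every $t\in T$ (uniformly in $t$), namely $M(t)=L_{UU}(t)^{-1}$ with $L_{UU}=\operatorname{diag}(L_{U_dU_d},L_{U_bU_b})$, such that: 1. for every $\gamma$, with the derivative taken at the current iterate along $dU/di=\gamma\,\delta U$, $$\frac{dJ}{di}=-\gamma\,\langle Q_U,MQ_U\rangle_T+O(\gamma^2)\qquad(\gamma\to0);$$ 2. the change of the cost over one update satisfies $$J(\bar U+\gamma\,\delta U)-J(\bar U)=-\gamma\,\langle Q_U,MQ_U\rangle_T+O(\gamma^2)\qquad(\gamma\to0);$$ 3. consequently, if $Q_U\neq0$ in $L_2^{k+l}(T)$, then $J(\bar U+\gamma\,\delta U)<J(\bar U)$ for all sufficiently small $\gamma>0$.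 -/

import Mathlib

open MeasureTheory Set Filter Topology
open scoped ENNReal InnerProductSpace ContDiff

noncomputable section

namespace STDDP

/-! ### Hilbert spaces over the domain and over its boundary -/

abbrev Euc (m : ℕ) := EuclideanSpace ℝ (Fin m)

/-- `L₂ᵐ(D)`: square integrable `ℝᵐ`-valued functions on the domain `D`. -/
abbrev L2D {d : ℕ} (D : Set (Euc d)) (m : ℕ) := Lp (Euc m) 2 (volume.restrict D)

/-- The surface measure on the boundary `S = ∂D`: the `(d-1)`-dimensional Hausdorff measure,
normalised to agree with Lebesgue measure on hyperplanes. -/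
def surface {d : ℕ} (D : Set (Euc d)) : Measure (Euc d) :=
  (Measure.euclideanHausdorffMeasure (d - 1)).restrict (frontier D)

/-- `L₂ᵐ(S)`: square integrable `ℝᵐ`-valued functions on the boundary `S = ∂D`. -/
abbrev L2S {d : ℕ} (D : Set (Euc d)) (m : ℕ) := Lp (Euc m) 2 (surface D)

/-- The triples (value on `D`, partial derivatives on `D`, value on `S`) of the smooth, compactly
supported functions `φ : ℝᵈ → ℝⁿ`. -/
def smoothFields {d : ℕ} (D : Set (Euc d)) (n : ℕ) :
    Submodule ℝ (L2D D n × (Fin d → L2D D n) × L2S D n) where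
  carrier := {p | ∃ φ : Euc d → Euc n, ContDiff ℝ ∞ φ ∧ HasCompactSupport φ ∧
    p.1 =ᵐ[volume.restrict D] φ ∧
    (∀ i, p.2.1 i =ᵐ[volume.restrict D] fun x => fderiv ℝ φ x (EuclideanSpace.single i 1)) ∧
    p.2.2 =ᵐ[surface D] φ}
  zero_mem' := by
    refine ⟨0, contDiff_const, HasCompactSupport.zero, Lp.coeFn_zero _ _ _, fun i => ?_,
      Lp.coeFn_zero _ _ _⟩
    filter_upwards [Lp.coeFn_zero (Euc n) 2 (volume.restrict D)] with x hx
    simpa using hx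
  add_mem' := by
    rintro p q ⟨φ, hφ, hφc, h1, h2, h3⟩ ⟨ψ, hψ, hψc, k1, k2, k3⟩
    refine ⟨φ + ψ, hφ.add hψ, hφc.add hψc, ?_, fun i => ?_, ?_⟩
    · exact (Lp.coeFn_add p.1 q.1).trans (h1.add k1)
    · refine (Lp.coeFn_add (p.2.1 i) (q.2.1 i)).trans ?_
      filter_upwards [h2 i, k2 i] with x hx kx
      rw [Pi.add_apply, hx, kx, fderiv_add (hφ.differentiable (by simp) x)
        (hψ.differentiable (by simp) x)]
      rfl
    · exact (Lp.coeFn_add p.2.2 q.2.2).trans (h3.add k3)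
  smul_mem' := by
    rintro c p ⟨φ, hφ, hφc, h1, h2, h3⟩
    refine ⟨c • φ, hφ.const_smul c, hφc.smul_left (f := fun _ => c), ?_, fun i => ?_, ?_⟩
    · exact (Lp.coeFn_smul c p.1).trans (h1.const_smul c)
    · refine (Lp.coeFn_smul c (p.2.1 i)).trans ?_
      filter_upwards [h2 i] with x hx
      rw [Pi.smul_apply, hx, fderiv_const_smul (hφ.differentiable (by simp) x)]
      rfl
    · exact (Lp.coeFn_smul c p.2.2).trans (h3.const_smul c)

/-- The triples whose boundary value vanishes almost everywhere on `Γ`. -/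
def zeroOn {d : ℕ} (D Γ : Set (Euc d)) (n : ℕ) :
    Submodule ℝ (L2D D n × (Fin d → L2D D n) × L2S D n) where
  carrier := {p | p.2.2 =ᵐ[(surface D).restrict Γ] (0 : Euc d → Euc n)}
  zero_mem' := ae_restrict_of_ae (Lp.coeFn_zero (Euc n) 2 (surface D))
  add_mem' := by
    intro p q hp hq
    have h := ae_restrict_of_ae (s := Γ) (Lp.coeFn_add p.2.2 q.2.2)
    change (p + q).2.2 =ᵐ[(surface D).restrict Γ] (0 : Euc d → Euc n)
    filter_upwards [h, hp, hq] with x hx hpx hqx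
    simpa [hpx, hqx] using hx
  smul_mem' := by
    intro c p hp
    have h := ae_restrict_of_ae (s := Γ) (Lp.coeFn_smul c p.2.2)
    change (c • p).2.2 =ᵐ[(surface D).restrict Γ] (0 : Euc d → Euc n)
    filter_upwards [h, hp] with x hx hpx
    simpa [hpx] using hx

/-- The Sobolev space `H¹(D; ℝⁿ)` of fields with gradient and trace, with vanishing trace on the
(possibly empty) part `Γ` of the boundary. A field is stored as the triple (value, weak partial
derivatives, trace); the space is the closure in `L₂` of the triples of smooth functions (for a
Lipschitz domain, value determines gradient and trace and this is the usual `H¹`),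
cut down to the triples with zero trace on `Γ`. -/
def fieldSpace {d : ℕ} (D Γ : Set (Euc d)) (n : ℕ) :
    Submodule ℝ (L2D D n × (Fin d → L2D D n) × L2S D n) :=
  (smoothFields D n).topologicalClosure ⊓ zeroOn D Γ n

section Fields

variable {d : ℕ} {D Γ : Set (Euc d)} {n : ℕ}

/-- The value of a field, as an element of `L₂ⁿ(D)`. -/
def val : fieldSpace D Γ n →L[ℝ] L2D D n :=
  (ContinuousLinearMap.fst ℝ _ _).comp (fieldSpace D Γ n).subtypeL

/-- The `i`-th weak partial derivative of a field. -/
def grad (i : Fin d) : fieldSpace D Γ n →L[ℝ] L2D D n :=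
  (ContinuousLinearMap.proj i).comp ((ContinuousLinearMap.fst ℝ _ _).comp
    ((ContinuousLinearMap.snd ℝ _ _).comp (fieldSpace D Γ n).subtypeL))

/-- The trace of a field on the boundary, as an element of `L₂ⁿ(S)`. -/
def tr : fieldSpace D Γ n →L[ℝ] L2S D n :=
  (ContinuousLinearMap.snd ℝ _ _).comp
    ((ContinuousLinearMap.snd ℝ _ _).comp (fieldSpace D Γ n).subtypeL)

/-- The weak form of the pair `(F, N)` with `F = ∑ᵢ ∂ᵢ aᵢ + f` in `D` and `N = ∑ᵢ νᵢ aᵢ + g` on `S`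
(`ν` the outer normal): if `N = 0`, then Gauss' theorem gives, for every test field `P`,
`⟨F, P⟩ = - ∑ᵢ ⟨aᵢ, ∂ᵢP⟩ + ⟨f, P⟩ - ⟨g, P⟩_S`. -/
def weakForm (a : Fin d → L2D D n) (f : L2D D n) (g : L2S D n) :
    fieldSpace D Γ n →L[ℝ] ℝ :=
  -(∑ i, (innerSL ℝ (a i)).comp (grad i)) + (innerSL ℝ f).comp val - (innerSL ℝ g).comp tr

/-- The weak form of the adjoint pair `(F_X^*, N_X^*)` applied to `q`, where `(F_X, N_X)` is the
linear pair with coefficients `aX, fX, gX`: by Green's formula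
`⟨q, F_X P⟩ - ⟨P, F_X^* q⟩ = ⟨q, N_X P⟩_S - ⟨P, N_X^* q⟩_S`, the functional
`P ↦ ⟨P, F_X^* q⟩ - ⟨P, N_X^* q⟩_S` is the weak form of `(F_X, N_X)` applied to `P`, tested
with `q`. -/
def adjointForm (aX : fieldSpace D Γ n →L[ℝ] (Fin d → L2D D n))
    (fX : fieldSpace D Γ n →L[ℝ] L2D D n) (gX : fieldSpace D Γ n →L[ℝ] L2S D n)
    (q : fieldSpace D Γ n) : fieldSpace D Γ n →L[ℝ] ℝ :=
  -(∑ i, (innerSL ℝ (grad i q)).comp ((ContinuousLinearMap.proj i).comp aX))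
    + (innerSL ℝ (val q)).comp fX - (innerSL ℝ (tr q)).comp gX

end Fields

/-! ### Trajectories and weak time derivatives -/

/-- Lebesgue measure on the time domain `T = [t₀, t_f]`. -/
def timeMeasure (t₀ tf : ℝ) : Measure ℝ := volume.restrict (Icc t₀ tf)

/-- A state trajectory is recorded by its value in `L₂ⁿ(D)` at every time, together with the
corresponding Sobolev field, which is meaningful at almost every time. -/
abbrev Path {d : ℕ} (D Γ : Set (Euc d)) (n : ℕ) := ℝ → L2D D n × fieldSpace D Γ n

section Paths

variable {d : ℕ} {D Γ : Set (Euc d)} {n : ℕ}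

/-- State trajectories: `C(T; L₂ⁿ(D)) ∩ L₂(T; H¹)`. -/
structure IsPath (t₀ tf : ℝ) (x : Path D Γ n) : Prop where
  cont : ContinuousOn (fun t => (x t).1) (Icc t₀ tf)
  memLp : MemLp (fun t => (x t).2) 2 (timeMeasure t₀ tf)
  val_eq : ∀ᵐ t ∂timeMeasure t₀ tf, val (x t).2 = (x t).1

/-- The norm of `C(T; L₂ⁿ(D)) ∩ L₂(T; H¹)`. -/
def pathNorm (t₀ tf : ℝ) (x : Path D Γ n) : ℝ :=
  sSup ((fun t => ‖(x t).1‖) '' Icc t₀ tf)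
    + (eLpNorm (fun t => (x t).2) 2 (timeMeasure t₀ tf)).toReal

/-- `dx/dt = ℓ` weakly on `T`, with `ℓ` in `L₂(T; (H¹)')`. -/
structure HasWeakTimeDeriv (t₀ tf : ℝ) (x : Path D Γ n)
    (ℓ : ℝ → (fieldSpace D Γ n →L[ℝ] ℝ)) : Prop where
  isPath : IsPath t₀ tf x
  memLp : MemLp ℓ 2 (timeMeasure t₀ tf)
  eq : ∀ P : fieldSpace D Γ n, ∀ t ∈ Icc t₀ tf,
    ⟪(x t).1, val P⟫_ℝ = ⟪(x t₀).1, val P⟫_ℝ + ∫ s in t₀..t, ℓ s P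

end Paths

/-! ### The controlled PDE and the cost -/

/-- A controlled PDE `∂ₜX = F(t, X, U_d)` in `D`, `0 = N(t, X, U_b)` on `S`, with
`F = ∑ᵢ ∂ᵢ aᵢ(t, X) + f(t, X, U_d)` and `N = ∑ᵢ νᵢ aᵢ(t, X) + g(t, X, U_b)`. The maps
`a = flux`, `f = source`, `g = bdry` may be nonlinear and nonlocal, and may depend on `∇X` and on
the trace of `X`. On `Γ` the homogeneous Dirichlet condition is imposed instead. -/
structure System {d : ℕ} (D Γ : Set (Euc d)) (n k l : ℕ) where
  flux : ℝ → fieldSpace D Γ n → (Fin d → L2D D n)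
  source : ℝ → fieldSpace D Γ n → L2D D k → L2D D n
  bdry : ℝ → fieldSpace D Γ n → L2S D l → L2S D n

/-- Running cost `L(t, X, U_d, U_b)` and terminal cost `φ(t, X)`. -/
structure Cost {d : ℕ} (D : Set (Euc d)) (n k l : ℕ) where
  running : ℝ → L2D D n → L2D D k → L2S D l → ℝ
  terminal : ℝ → L2D D n → ℝ

section Problem

variable {d : ℕ} {D Γ : Set (Euc d)} {n k l : ℕ}

/-- The weak form of the dynamics and boundary condition at time `t`. -/
def System.rhs (sys : System D Γ n k l) (t : ℝ) (X : fieldSpace D Γ n) (ud : L2D D k)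
    (ub : L2S D l) : fieldSpace D Γ n →L[ℝ] ℝ :=
  weakForm (sys.flux t X) (sys.source t X ud) (sys.bdry t X ub)

/-- `x` is a weak solution of the PDE with controls `ud`, `ub` and initial condition `X₀`. -/
def System.IsSolution (sys : System D Γ n k l) (t₀ tf : ℝ) (X₀ : L2D D n) (ud : ℝ → L2D D k)
    (ub : ℝ → L2S D l) (x : Path D Γ n) : Prop :=
  HasWeakTimeDeriv t₀ tf x (fun t => sys.rhs t (x t).2 (ud t) (ub t)) ∧ (x t₀).1 = X₀

/-- Well-posedness in the sense of Hadamard: existence, uniqueness and continuous dependence of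
the weak solution on the initial condition and on the controls. -/
structure System.WellPosed (sys : System D Γ n k l) (t₀ tf : ℝ) : Prop where
  existence : ∀ (X₀ : L2D D n) (ud : ℝ → L2D D k) (ub : ℝ → L2S D l),
    MemLp ud 2 (timeMeasure t₀ tf) → MemLp ub 2 (timeMeasure t₀ tf) →
    ∃ x : Path D Γ n, sys.IsSolution t₀ tf X₀ ud ub x
  uniqueness : ∀ (X₀ : L2D D n) (ud : ℝ → L2D D k) (ub : ℝ → L2S D l),
    MemLp ud 2 (timeMeasure t₀ tf) → MemLp ub 2 (timeMeasure t₀ tf) →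
    ∀ x y : Path D Γ n, sys.IsSolution t₀ tf X₀ ud ub x → sys.IsSolution t₀ tf X₀ ud ub y →
      (∀ t ∈ Icc t₀ tf, (x t).1 = (y t).1) ∧ ∀ᵐ t ∂timeMeasure t₀ tf, (x t).2 = (y t).2
  stability : ∀ (X₀ : L2D D n) (ud : ℝ → L2D D k) (ub : ℝ → L2S D l) (x : Path D Γ n),
    MemLp ud 2 (timeMeasure t₀ tf) → MemLp ub 2 (timeMeasure t₀ tf) →
    sys.IsSolution t₀ tf X₀ ud ub x →
    ∀ ε > 0, ∃ δ > 0, ∀ (X₀' : L2D D n) (ud' : ℝ → L2D D k) (ub' : ℝ → L2S D l) (x' : Path D Γ n),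
      MemLp ud' 2 (timeMeasure t₀ tf) → MemLp ub' 2 (timeMeasure t₀ tf) →
      sys.IsSolution t₀ tf X₀' ud' ub' x' →
      ‖X₀' - X₀‖ < δ →
      eLpNorm (ud' - ud) 2 (timeMeasure t₀ tf) < ENNReal.ofReal δ →
      eLpNorm (ub' - ub) 2 (timeMeasure t₀ tf) < ENNReal.ofReal δ →
      pathNorm t₀ tf (x' - x) < ε

/-- The cost `J = φ(t_f, X(t_f)) + ∫ L(t, X(t), U_d(t), U_b(t)) dt`. -/
def Cost.total (C : Cost D n k l) (t₀ tf : ℝ) (x : Path D Γ n) (ud : ℝ → L2D D k)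
    (ub : ℝ → L2S D l) : ℝ :=
  C.terminal tf (x tf).1 + ∫ t in t₀..tf, C.running t (x t).1 (ud t) (ub t)

end Problem

/-! ### Expansion along a nominal trajectory -/

/-- The derivatives along a nominal trajectory, as functions of time: the linearised dynamics
`F_X = ∑ᵢ ∂ᵢ aXᵢ + fX`, `F_{U_d} = FU` and boundary operator `N_X = ∑ᵢ νᵢ aXᵢ + gX`, `N_{U_b} = NU`,
and the first and second derivatives of the running and terminal costs. There are no cross terms,
so only the diagonal blocks of the second derivative of `L` are recorded. -/
structure Derivs {d : ℕ} (D Γ : Set (Euc d)) (n k l : ℕ) where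
  aX : ℝ → fieldSpace D Γ n →L[ℝ] (Fin d → L2D D n)
  fX : ℝ → fieldSpace D Γ n →L[ℝ] L2D D n
  gX : ℝ → fieldSpace D Γ n →L[ℝ] L2S D n
  FU : ℝ → L2D D k →L[ℝ] L2D D n
  NU : ℝ → L2S D l →L[ℝ] L2S D n
  LX : ℝ → L2D D n
  LUd : ℝ → L2D D k
  LUb : ℝ → L2S D l
  LXX : ℝ → L2D D n →L[ℝ] L2D D n
  LUdUd : ℝ → L2D D k →L[ℝ] L2D D k
  LUbUb : ℝ → L2S D l →L[ℝ] L2S D l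
  φX : L2D D n
  φXX : L2D D n →L[ℝ] L2D D n

section Expansion

variable {d : ℕ} {D Γ : Set (Euc d)} {n k l : ℕ}

/-- `A` consists of the Gateaux derivatives of the dynamics and of the boundary operator at the
nominal trajectory `(x, ud, ub)`. -/
def Derivs.OfSystem (A : Derivs D Γ n k l) (sys : System D Γ n k l) (t₀ tf : ℝ) (x : Path D Γ n)
    (ud : ℝ → L2D D k) (ub : ℝ → L2S D l) : Prop :=
  ∀ᵐ t ∂timeMeasure t₀ tf, ∀ (h : fieldSpace D Γ n) (v : L2D D k) (w : L2S D l),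
    HasDerivAt (fun s : ℝ => sys.flux t ((x t).2 + s • h)) (A.aX t h) 0 ∧
    HasDerivAt (fun s : ℝ => sys.source t ((x t).2 + s • h) (ud t + s • v))
      (A.fX t h + A.FU t v) 0 ∧
    HasDerivAt (fun s : ℝ => sys.bdry t ((x t).2 + s • h) (ub t + s • w))
      (A.gX t h + A.NU t w) 0

/-- `A` consists of the Gateaux derivatives of the costs at the nominal trajectory `(x, ud, ub)`:
`L` and `φ` have Gateaux gradients everywhere, and these are Gateaux differentiable at the
nominal point with the recorded second derivatives. The cross derivatives
`L_{U_d X}, L_{U_b X}, L_{X U_d}, L_{X U_b}, L_{U_d U_b}, L_{U_b U_d}` vanish there. -/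
def Derivs.OfCost (A : Derivs D Γ n k l) (C : Cost D n k l) (t₀ tf : ℝ) (x : Path D Γ n)
    (ud : ℝ → L2D D k) (ub : ℝ → L2S D l) : Prop :=
  (∀ t ∈ Icc t₀ tf, ∃ (GX : L2D D n → L2D D k → L2S D l → L2D D n)
    (Gd : L2D D n → L2D D k → L2S D l → L2D D k) (Gb : L2D D n → L2D D k → L2S D l → L2S D l),
    (∀ (X : L2D D n) (u : L2D D k) (b : L2S D l) (h : L2D D n) (v : L2D D k) (w : L2S D l),
      HasDerivAt (fun s : ℝ => C.running t (X + s • h) (u + s • v) (b + s • w))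
        (⟪GX X u b, h⟫_ℝ + ⟪Gd X u b, v⟫_ℝ + ⟪Gb X u b, w⟫_ℝ) 0) ∧
    A.LX t = GX (x t).1 (ud t) (ub t) ∧
    A.LUd t = Gd (x t).1 (ud t) (ub t) ∧
    A.LUb t = Gb (x t).1 (ud t) (ub t) ∧
    ∀ (h : L2D D n) (v : L2D D k) (w : L2S D l),
      HasDerivAt (fun s : ℝ => GX ((x t).1 + s • h) (ud t + s • v) (ub t + s • w))
        (A.LXX t h) 0 ∧
      HasDerivAt (fun s : ℝ => Gd ((x t).1 + s • h) (ud t + s • v) (ub t + s • w))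
        (A.LUdUd t v) 0 ∧
      HasDerivAt (fun s : ℝ => Gb ((x t).1 + s • h) (ud t + s • v) (ub t + s • w))
        (A.LUbUb t w) 0) ∧
  ∃ Gφ : L2D D n → L2D D n,
    (∀ X h : L2D D n, HasDerivAt (fun s : ℝ => C.terminal tf (X + s • h)) ⟪Gφ X, h⟫_ℝ 0) ∧
    A.φX = Gφ (x tf).1 ∧
    ∀ h : L2D D n, HasDerivAt (fun s : ℝ => Gφ ((x tf).1 + s • h)) (A.φXX h) 0

/-- The expansion of the dynamics and of the boundary operator around the nominal trajectory has a
remainder of second order, for state variations `h` and control variations `γ (vd, vb)`: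
the remainder is `O((‖h‖ + |γ|)²)` in `L₂(T; (H¹)')`. -/
def Derivs.SystemExpansion (A : Derivs D Γ n k l) (sys : System D Γ n k l) (t₀ tf : ℝ)
    (x : Path D Γ n) (ud vd : ℝ → L2D D k) (ub vb : ℝ → L2S D l) : Prop :=
  ∃ K : ℝ, ∃ r > 0, ∀ (γ : ℝ) (h : Path D Γ n), |γ| ≤ r → IsPath t₀ tf h →
    pathNorm t₀ tf h ≤ r →
    let R : ℝ → (fieldSpace D Γ n →L[ℝ] ℝ) := fun t =>
      sys.rhs t ((x t).2 + (h t).2) (ud t + γ • vd t) (ub t + γ • vb t)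
        - sys.rhs t (x t).2 (ud t) (ub t)
        - weakForm (A.aX t (h t).2) (A.fX t (h t).2 + A.FU t (γ • vd t))
            (A.gX t (h t).2 + A.NU t (γ • vb t))
    MemLp R 2 (timeMeasure t₀ tf) ∧
    eLpNorm R 2 (timeMeasure t₀ tf) ≤ ENNReal.ofReal (K * (pathNorm t₀ tf h + |γ|) ^ 2)

/-- The first order expansions of the running and of the terminal cost around the nominal
trajectory have remainders of second order. -/
def Derivs.CostExpansion (A : Derivs D Γ n k l) (C : Cost D n k l) (t₀ tf : ℝ)
    (x : Path D Γ n) (ud vd : ℝ → L2D D k) (ub vb : ℝ → L2S D l) : Prop :=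
  (∃ K : ℝ, ∃ r > 0, ∀ (γ : ℝ) (h : Path D Γ n), |γ| ≤ r → IsPath t₀ tf h →
    pathNorm t₀ tf h ≤ r →
    IntegrableOn (fun t => C.running t ((x t).1 + (h t).1) (ud t + γ • vd t) (ub t + γ • vb t))
      (Icc t₀ tf) ∧
    |∫ t in t₀..tf, (C.running t ((x t).1 + (h t).1) (ud t + γ • vd t) (ub t + γ • vb t)
        - C.running t (x t).1 (ud t) (ub t)
        - (⟪A.LX t, (h t).1⟫_ℝ + ⟪A.LUd t, γ • vd t⟫_ℝ + ⟪A.LUb t, γ • vb t⟫_ℝ))|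
      ≤ K * (pathNorm t₀ tf h + |γ|) ^ 2) ∧
  ∃ K : ℝ, ∃ r > 0, ∀ h : L2D D n, ‖h‖ ≤ r →
    |C.terminal tf ((x tf).1 + h) - C.terminal tf (x tf).1 - ⟪A.φX, h⟫_ℝ| ≤ K * ‖h‖ ^ 2

/-- The approximate variation system is well posed (it generates a linear evolution system): for
every initial variation and every forcing in `L₂(T; (H¹)')` there is a weak solution,
and weak solutions depend boundedly on these data. -/
structure Derivs.VariationWellPosed (A : Derivs D Γ n k l) (t₀ tf : ℝ) : Prop where
  existence : ∀ (y₀ : L2D D n) (ℓ : ℝ → (fieldSpace D Γ n →L[ℝ] ℝ)),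
    MemLp ℓ 2 (timeMeasure t₀ tf) → ∃ y : Path D Γ n, (y t₀).1 = y₀ ∧
      HasWeakTimeDeriv t₀ tf y (fun t =>
        weakForm (A.aX t (y t).2) (A.fX t (y t).2) (A.gX t (y t).2) + ℓ t)
  stability : ∃ K : ℝ, ∀ (ℓ : ℝ → (fieldSpace D Γ n →L[ℝ] ℝ)) (y : Path D Γ n),
    MemLp ℓ 2 (timeMeasure t₀ tf) →
    HasWeakTimeDeriv t₀ tf y (fun t =>
      weakForm (A.aX t (y t).2) (A.fX t (y t).2) (A.gX t (y t).2) + ℓ t) →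
    pathNorm t₀ tf y ≤ K * (‖(y t₀).1‖ + (eLpNorm ℓ 2 (timeMeasure t₀ tf)).toReal)

/-- The square integrability of the first derivatives of `L` along the nominal trajectory, and the
symmetry and positive definiteness of `L_{U_d U_d}` and `L_{U_b U_b}`. These act as bounded operators
with bounded inverses on the trajectory space, so the bounds are uniform in time. -/
structure Derivs.Regular (A : Derivs D Γ n k l) (t₀ tf : ℝ) : Prop where
  memLp_LX : MemLp A.LX 2 (timeMeasure t₀ tf)
  memLp_LUd : MemLp A.LUd 2 (timeMeasure t₀ tf)
  memLp_LUb : MemLp A.LUb 2 (timeMeasure t₀ tf)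
  meas_d : ∀ u, AEStronglyMeasurable (fun t => A.LUdUd t u) (timeMeasure t₀ tf)
  meas_b : ∀ u, AEStronglyMeasurable (fun t => A.LUbUb t u) (timeMeasure t₀ tf)
  symm_d : ∀ t ∈ Icc t₀ tf, ∀ u v, ⟪A.LUdUd t u, v⟫_ℝ = ⟪u, A.LUdUd t v⟫_ℝ
  symm_b : ∀ t ∈ Icc t₀ tf, ∀ u v, ⟪A.LUbUb t u, v⟫_ℝ = ⟪u, A.LUbUb t v⟫_ℝ
  bdd_d : ∃ K, ∀ t ∈ Icc t₀ tf, ‖A.LUdUd t‖ ≤ K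
  bdd_b : ∃ K, ∀ t ∈ Icc t₀ tf, ‖A.LUbUb t‖ ≤ K
  pos_d : ∃ m > 0, ∀ t ∈ Icc t₀ tf, ∀ u, m * ‖u‖ ^ 2 ≤ ⟪u, A.LUdUd t u⟫_ℝ
  pos_b : ∃ m > 0, ∀ t ∈ Icc t₀ tf, ∀ u, m * ‖u‖ ^ 2 ≤ ⟪u, A.LUbUb t u⟫_ℝ

end Expansion

/-! ### The STDDP sweep -/

/-- `V_XX` as a function of time: an operator on `L₂ⁿ(D)` for every time, together with its action
on Sobolev fields (needed for its boundary values), which is meaningful at almost every time. -/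
abbrev OpPath {d : ℕ} (D Γ : Set (Euc d)) (n : ℕ) :=
  ℝ → (L2D D n →L[ℝ] L2D D n) × (fieldSpace D Γ n →L[ℝ] fieldSpace D Γ n)

section Sweep

variable {d : ℕ} {D Γ : Set (Euc d)} {n k l : ℕ}

/-- `L_{U_d U_d}⁻¹` -/
def Derivs.invd (A : Derivs D Γ n k l) (t : ℝ) : L2D D k →L[ℝ] L2D D k := Ring.inverse (A.LUdUd t)

/-- `L_{U_b U_b}⁻¹` -/
def Derivs.invb (A : Derivs D Γ n k l) (t : ℝ) : L2S D l →L[ℝ] L2S D l := Ring.inverse (A.LUbUb t)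

/-- `Q_{U_d} = L_{U_d} + F_{U_d}ᵀ V_X` -/
def Derivs.Qd (A : Derivs D Γ n k l) (VX : Path D Γ n) (t : ℝ) : L2D D k :=
  A.LUd t + (A.FU t).adjoint (VX t).1

/-- `Q_{U_b} = L_{U_b} - N_{U_b}ᵀ V_X`, with `V_X` evaluated on the boundary -/
def Derivs.Qb (A : Derivs D Γ n k l) (VX : Path D Γ n) (t : ℝ) : L2S D l :=
  A.LUb t - (A.NU t).adjoint (tr (VX t).2)

/-- `Q_{U_d X} = F_{U_d}ᵀ V_XX` (no cross terms) -/
def Derivs.QdX (A : Derivs D Γ n k l) (VXX : OpPath D Γ n) (t : ℝ) :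
    fieldSpace D Γ n →L[ℝ] L2D D k :=
  (A.FU t).adjoint.comp (val.comp (VXX t).2)

/-- `Q_{U_b X} = - N_{U_b}ᵀ V_XX` (no cross terms), with `V_XX` evaluated on the boundary -/
def Derivs.QbX (A : Derivs D Γ n k l) (VXX : OpPath D Γ n) (t : ℝ) :
    fieldSpace D Γ n →L[ℝ] L2S D l :=
  -((A.NU t).adjoint.comp (tr.comp (VXX t).2))

/-- The distributed control update
`δU_d = - L_{U_d U_d}⁻¹ (L_{U_d} + F_{U_d}ᵀ V_X) - L_{U_d U_d}⁻¹ F_{U_d}ᵀ V_XX δX`. -/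
def Derivs.δUd (A : Derivs D Γ n k l) (VX : Path D Γ n) (VXX : OpPath D Γ n) (δX : Path D Γ n)
    (t : ℝ) : L2D D k :=
  -A.invd t (A.Qd VX t) - A.invd t (A.QdX VXX t (δX t).2)

/-- The boundary control update
`δU_b = - L_{U_b U_b}⁻¹ (L_{U_b} - N_{U_b}ᵀ V_X) + L_{U_b U_b}⁻¹ N_{U_b}ᵀ V_XX δX`. -/
def Derivs.δUb (A : Derivs D Γ n k l) (VX : Path D Γ n) (VXX : OpPath D Γ n) (δX : Path D Γ n)
    (t : ℝ) : L2S D l :=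
  -A.invb t (A.Qb VX t) - A.invb t (A.QbX VXX t (δX t).2)

/-- The first order backward equation, in weak form: in `D`
`-dV_X/dt = L_X + F_X^* V_X - Q_{X U_d} L_{U_d U_d}⁻¹ Q_{U_d} - Q_{X U_b} L_{U_b U_b}⁻¹ Q_{U_b}`,
on `S` the boundary condition `N_X^* V_X = 0`, and `V_X(t_f) = φ_X`. -/
def Derivs.BackwardFirst (A : Derivs D Γ n k l) (t₀ tf : ℝ) (VX : Path D Γ n)
    (VXX : OpPath D Γ n) : Prop :=
  HasWeakTimeDeriv t₀ tf VX (fun t =>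
    -((innerSL ℝ (A.LX t)).comp val + adjointForm (A.aX t) (A.fX t) (A.gX t) (VX t).2
      - (innerSL ℝ (A.invd t (A.Qd VX t))).comp (A.QdX VXX t)
      - (innerSL ℝ (A.invb t (A.Qb VX t))).comp (A.QbX VXX t))) ∧
  (VX tf).1 = A.φX

/-- The second order backward equation, in weak form: in `D`
`-dV_XX/dt = L_XX + F_X^* V_XX + [F_X^* V_XX]ᵀ
  - Q_{X U_d} L_{U_d U_d}⁻¹ Q_{U_d X} - Q_{X U_b} L_{U_b U_b}⁻¹ Q_{U_b X}`,
on `S` the boundary condition `N_X^* V_XX = 0`, and `V_XX(t_f) = φ_XX`; `V_XX` is symmetric. -/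
structure Derivs.BackwardSecond (A : Derivs D Γ n k l) (t₀ tf : ℝ) (VXX : OpPath D Γ n) :
    Prop where
  val_eq : ∀ᵐ t ∂timeMeasure t₀ tf, ∀ P, val ((VXX t).2 P) = (VXX t).1 (val P)
  symm : ∀ t ∈ Icc t₀ tf, ∀ P R, ⟪(VXX t).1 P, R⟫_ℝ = ⟪P, (VXX t).1 R⟫_ℝ
  integrable : ∀ P R : fieldSpace D Γ n, IntegrableOn (fun s =>
      ⟪val P, A.LXX s (val R)⟫_ℝ
        + adjointForm (A.aX s) (A.fX s) (A.gX s) ((VXX s).2 R) P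
        + adjointForm (A.aX s) (A.fX s) (A.gX s) ((VXX s).2 P) R
        - ⟪A.QdX VXX s P, A.invd s (A.QdX VXX s R)⟫_ℝ
        - ⟪A.QbX VXX s P, A.invb s (A.QbX VXX s R)⟫_ℝ) (Icc t₀ tf)
  eq : ∀ P R : fieldSpace D Γ n, ∀ t ∈ Icc t₀ tf,
    ⟪val P, (VXX t).1 (val R)⟫_ℝ = ⟪val P, A.φXX (val R)⟫_ℝ + ∫ s in t..tf,
      (⟪val P, A.LXX s (val R)⟫_ℝ
        + adjointForm (A.aX s) (A.fX s) (A.gX s) ((VXX s).2 R) P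
        + adjointForm (A.aX s) (A.fX s) (A.gX s) ((VXX s).2 P) R
        - ⟪A.QdX VXX s P, A.invd s (A.QdX VXX s R)⟫_ℝ
        - ⟪A.QbX VXX s P, A.invb s (A.QbX VXX s R)⟫_ℝ)

/-- The approximate variation dynamics, in weak form, with the STDDP updates as controls:
`dδX/dt = F_X δX + F_{U_d} δU_d` in `D`, `0 = N_X δX + N_{U_b} δU_b` on `S`, `δX(t₀) = 0`. -/
def Derivs.Variation (A : Derivs D Γ n k l) (t₀ tf : ℝ) (VX : Path D Γ n) (VXX : OpPath D Γ n)
    (δX : Path D Γ n) : Prop :=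
  HasWeakTimeDeriv t₀ tf δX (fun t =>
    weakForm (A.aX t (δX t).2) (A.fX t (δX t).2 + A.FU t (A.δUd VX VXX δX t))
      (A.gX t (δX t).2 + A.NU t (A.δUb VX VXX δX t))) ∧
  (δX t₀).1 = 0

end Sweep

/-- `L₂^{k+l}(D̄)`: the Hilbert space of stacked controls `U = (U_d, U_b)`. -/
abbrev Ctrl {d : ℕ} (D : Set (Euc d)) (k l : ℕ) := WithLp 2 (L2D D k × L2S D l)

section Stacked

variable {d : ℕ} {D Γ : Set (Euc d)} {n k l : ℕ}

/-- `Q_U = (Q_{U_d}, Q_{U_b})` -/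
def Derivs.QU (A : Derivs D Γ n k l) (VX : Path D Γ n) (t : ℝ) : Ctrl D k l :=
  WithLp.toLp 2 (A.Qd VX t, A.Qb VX t)

end Stacked

end STDDP

end

/-!
The first variation of the cost in the direction of the update is paired with the backward value
equation: integrating `d/dt ⟪V_X, δX⟫` by parts replaces the terms in `δX` by `Q_U` and by the
feedback terms of the value equation. The feedback part of `δU` cancels the latter, and what
remains is `-⟪Q_U, L_UU⁻¹ Q_U⟫`, a negative definite form because `L_UU` is symmetric and uniformly
positive definite. The remainders are quadratic: if `z` is the change of the state minus `γ δX`,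
then `z` solves the linearised system with the second order remainder of the dynamics as forcing.
Well-posedness of that system bounds `z` by `(‖z + γ δX‖ + |γ|)²`. Since `z + γ δX` tends to `0` by
well-posedness of the PDE, the square can be absorbed, which gives first `z + γ δX = O(γ)` and then
`z = O(γ²)`.
-/

namespace STDDP

/-! ### Integration by parts in Bochner spaces -/

section Translation

variable {E F : Type*} [NormedAddCommGroup E] [NormedAddCommGroup F] {p q : ℝ≥0∞}

theorem tendsto_eLpNorm_translate_sub [Fact (1 ≤ p)] (hp : p ≠ ⊤) {f : ℝ → E}
    (hf : MemLp f p) :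
    Tendsto (fun τ : ℝ => eLpNorm (fun t => f (τ + t) - f t) p) (𝓝 0) (𝓝 0) := by
  have := Fact.mk hp
  have hcont : Continuous fun τ : ℝ => DomAddAct.mk τ +ᵥ hf.toLp f :=
    (continuous_id.vadd continuous_const).comp DomAddAct.mkHomeomorph.continuous
  have hlim : Tendsto (fun τ : ℝ => ‖(DomAddAct.mk τ +ᵥ hf.toLp f) - hf.toLp f‖ₑ) (𝓝 0) (𝓝 0) := by
    simpa using (hcont.sub (continuous_const (y := hf.toLp f))).enorm.tendsto 0
  refine hlim.congr fun τ => ?_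
  rw [DomAddAct.mk_vadd_toLp, ← MemLp.toLp_sub, Lp.enorm_toLp]
  rfl

theorem aemeasurable_enorm_mul_enorm_translate_sub {f : ℝ → E} {g : ℝ → F}
    (hf : AEStronglyMeasurable f) (hg : AEStronglyMeasurable g) (e : ℝ) (ν : Measure ℝ)
    [SFinite ν] :
    AEMeasurable (fun z : ℝ × ℝ => ‖f (z.2 + z.1)‖ₑ * ‖g (e + z.1) - g (z.2 + z.1)‖ₑ)
      (volume.prod ν) := by
  have hadd := quasiMeasurePreserving_add_swap (volume : Measure ℝ) ν
  have hshift : Measure.QuasiMeasurePreserving (fun z : ℝ × ℝ => e + z.1)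
      (volume.prod ν) volume :=
    (quasiMeasurePreserving_add_left volume e).comp Measure.quasiMeasurePreserving_fst
  exact (hf.comp_quasiMeasurePreserving hadd).enorm.mul
    ((hg.comp_quasiMeasurePreserving hshift).sub (hg.comp_quasiMeasurePreserving hadd)).enorm

theorem lintegral_enorm_mul_enorm_le [p.HolderConjugate q] {α : Type*} [MeasurableSpace α]
    {μ : Measure α} {f : α → E} {g : α → F}
    (hf : AEStronglyMeasurable f μ) (hg : AEStronglyMeasurable g μ) :
    ∫⁻ t, ‖f t‖ₑ * ‖g t‖ₑ ∂μ ≤ eLpNorm f p μ * eLpNorm g q μ := by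
  simpa [eLpNorm_one_eq_lintegral_enorm, enorm_mul] using
    eLpNorm_smul_le_mul_eLpNorm (p := p) (q := q) (r := 1) hg.norm hf.norm

theorem lintegral_enorm_mul_enorm_translate_sub_le [p.HolderConjugate q] {f : ℝ → E} {g : ℝ → F}
    (hf : AEStronglyMeasurable f) (hg : AEStronglyMeasurable g) (e r : ℝ) :
    ∫⁻ t, ‖f (r + t)‖ₑ * ‖g (e + t) - g (r + t)‖ₑ
      ≤ eLpNorm f p * eLpNorm (fun t => g (e - r + t) - g t) q := by
  have hsub : AEStronglyMeasurable fun t => g (e - r + t) - g t :=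
    (hg.comp_quasiMeasurePreserving (quasiMeasurePreserving_add_left volume (e - r))).sub hg
  have hshift : ∫⁻ t, ‖f (r + t)‖ₑ * ‖g (e + t) - g (r + t)‖ₑ
      = ∫⁻ t, ‖f t‖ₑ * ‖g (e - r + t) - g t‖ₑ := by
    rw [← lintegral_add_left_eq_self (fun t => ‖f t‖ₑ * ‖g (e - r + t) - g t‖ₑ) r]
    simp only [← add_assoc, sub_add_cancel]
  exact hshift.trans_le (lintegral_enorm_mul_enorm_le hf hsub)

theorem eventually_lintegral_enorm_mul_enorm_translate_sub_le [p.HolderConjugate q] [Fact (1 ≤ q)]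
    (hq : q ≠ ⊤) {f : ℝ → E} {g : ℝ → F} (hf : MemLp f p) (hg : MemLp g q) {ε : ℝ}
    (hε : 0 < ε) :
    ∀ᶠ δ in 𝓝[>] (0 : ℝ), ∀ e ∈ Icc 0 δ,
      ∫⁻ t, ∫⁻ r in Ioc 0 δ, ‖f (r + t)‖ₑ * ‖g (e + t) - g (r + t)‖ₑ
        ≤ ENNReal.ofReal (ε * δ) := by
  have hsmall : ∀ᶠ τ in 𝓝 (0 : ℝ),
      eLpNorm f p * eLpNorm (fun t => g (τ + t) - g t) q ≤ ENNReal.ofReal ε := by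
    refine Tendsto.eventually_le_const (v := 0) (by simpa using hε) ?_
    simpa using ENNReal.Tendsto.const_mul (tendsto_eLpNorm_translate_sub hq hg) (.inr hf.2.ne)
  obtain ⟨δ₀, hδ₀, hsmall⟩ := Metric.eventually_nhds_iff.1 hsmall
  filter_upwards [Ioo_mem_nhdsGT hδ₀] with δ hδ e he
  rw [lintegral_lintegral_swap (aemeasurable_enorm_mul_enorm_translate_sub hf.1 hg.1 e _)]
  calc ∫⁻ r in Ioc 0 δ, ∫⁻ t, ‖f (r + t)‖ₑ * ‖g (e + t) - g (r + t)‖ₑ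
    _ ≤ ∫⁻ _ in Ioc 0 δ, ENNReal.ofReal ε := by
        refine setLIntegral_mono' measurableSet_Ioc fun r hr => ?_
        refine (lintegral_enorm_mul_enorm_translate_sub_le hf.1 hg.1 e r).trans (hsmall ?_)
        rw [Real.dist_eq, sub_zero, abs_lt]
        constructor <;> linarith [hδ.2, he.1, he.2, hr.1, hr.2]
    _ = ENNReal.ofReal (ε * δ) := by simp [ENNReal.ofReal_mul hε.le]

end Translation

section Increments

variable {E : Type*} [NormedAddCommGroup E] [NormedSpace ℝ E] [CompleteSpace E]

theorem hasDerivAt_integral_translate_sub {f : ℝ → E} (hf : Continuous f) (a b : ℝ) :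
    HasDerivAt (fun δ => ∫ t in a..(b - δ), (f (δ + t) - f t)) (f b - f a) 0 := by
  have hint (u v : ℝ) : IntervalIntegrable f volume u v := hf.intervalIntegrable u v
  have hsplit (δ : ℝ) : ∫ t in a..(b - δ), (f (δ + t) - f t)
      = (∫ t in (a + δ)..b, f t) - ∫ t in a..(b - δ), f t := by
    rw [intervalIntegral.integral_sub (by simpa using (hint (a + δ) b).comp_add_left δ)
      (hint _ _), intervalIntegral.integral_comp_add_left f δ, add_comm δ a, add_sub_cancel]
  have hleft : HasDerivAt (fun δ => ∫ t in (a + δ)..b, f t) (-f a) 0 := by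
    refine HasDerivAt.comp_const_add (f := fun u => ∫ t in u..b, f t) a 0 ?_
    exact intervalIntegral.integral_hasDerivAt_left (hint _ b)
      (hf.stronglyMeasurableAtFilter _ _) hf.continuousAt |>.congr_deriv (by simp)
  have hright : HasDerivAt (fun δ => ∫ t in a..(b - δ), f t) (-f b) 0 := by
    refine HasDerivAt.comp_const_sub (f := fun u => ∫ t in a..u, f t) b 0 ?_
    simpa using intervalIntegral.integral_hasDerivAt_right (hint a (b - 0))
      (hf.stronglyMeasurableAtFilter _ _) hf.continuousAt
  simp only [hsplit]
  exact (hleft.fun_sub hright).congr_deriv (by abel)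

theorem eq_of_integral_translate_sub_isLittleO {a b : ℝ} (hab : a ≤ b) {f : ℝ → E}
    (hf : ContinuousOn f (Icc a b))
    (h : (fun δ => ∫ t in a..(b - δ), (f (δ + t) - f t)) =o[𝓝[>] 0] fun δ => δ) :
    f b = f a := by
  rcases hab.eq_or_lt with rfl | hab
  · rfl
  set g : ℝ → E := IccExtend hab.le ((Icc a b).domRestrict f)
  have hg : Continuous g := hf.domRestrict.Icc_extend'
  have hgf : EqOn g f (Icc a b) := fun t ht => IccExtend_of_mem hab.le _ ht
  have hcongr : (fun δ => ∫ t in a..(b - δ), (f (δ + t) - f t))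
      =ᶠ[𝓝[>] 0] fun δ => ∫ t in a..(b - δ), (g (δ + t) - g t) := by
    filter_upwards [Ioo_mem_nhdsGT (sub_pos.2 hab)] with δ hδ
    refine intervalIntegral.integral_congr fun t ht => ?_
    rw [uIcc_of_le (by linarith [hδ.2])] at ht
    simp only [hgf ⟨ht.1, by linarith [ht.2, hδ.1]⟩,
      hgf (x := δ + t) ⟨by linarith [ht.1, hδ.1], by linarith [ht.2]⟩]
  have hzero : HasDerivWithinAt (fun δ => ∫ t in a..(b - δ), (g (δ + t) - g t)) 0 (Ioi 0) 0 := by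
    rw [hasDerivWithinAt_iff_isLittleO]
    simpa using h.congr' hcongr .rfl
  have hderiv := (hasDerivAt_integral_translate_sub hg a b).hasDerivWithinAt (s := Ioi 0)
  have := (uniqueDiffWithinAt_Ioi (0 : ℝ)).eq_deriv _ hderiv hzero
  rwa [hgf ⟨hab.le, le_rfl⟩, hgf ⟨le_rfl, hab.le⟩, sub_eq_zero] at this

end Increments

section IntegrationByParts

variable {V H : Type*} [NormedAddCommGroup V] [NormedSpace ℝ V] [NormedAddCommGroup H]
  [InnerProductSpace ℝ H] {ι : V →L[ℝ] H} {a b : ℝ} {x y : ℝ → H} {X Y : ℝ → V}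
  {ℓ m : ℝ → V →L[ℝ] ℝ}

theorem integrable_clm_apply {α : Type*} [MeasurableSpace α] {μ : Measure α} {p q : ℝ≥0∞}
    [p.HolderConjugate q] {ℓ : α → V →L[ℝ] ℝ} {X : α → V} (hℓ : MemLp ℓ p μ) (hX : MemLp X q μ) :
    Integrable (fun s => ℓ s (X s)) μ :=
  memLp_one_iff_integrable.1 ((ContinuousLinearMap.id ℝ (V →L[ℝ] ℝ)).memLp_of_bilin 1 hℓ hX)

theorem intervalIntegrable_clm_apply {p : ℝ≥0∞} [Fact (1 ≤ p)] (hℓ : MemLp ℓ p) (P : V)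
    (u v : ℝ) : IntervalIntegrable (fun s => ℓ s P) volume u v :=
  (((ContinuousLinearMap.apply ℝ ℝ P).comp_memLp' hℓ).locallyIntegrable Fact.out
    |>.integrableOn_isCompact isCompact_uIcc).intervalIntegrable

theorem enorm_intervalIntegral_clm_apply_le (ℓ : ℝ → V →L[ℝ] ℝ) (X : ℝ → V) {t δ : ℝ}
    (hδ : 0 ≤ δ) :
    ‖∫ s in t..(δ + t), ℓ s (X s)‖ₑ ≤ ∫⁻ r in Ioc 0 δ, ‖ℓ (r + t)‖ₑ * ‖X (r + t)‖ₑ := by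
  have hshift := intervalIntegral.integral_comp_add_right (a := 0) (b := δ)
    (fun s => ℓ s (X s)) t
  rw [zero_add] at hshift
  rw [← hshift, intervalIntegral.integral_of_le hδ]
  exact (enorm_integral_le_lintegral_enorm _).trans
    (lintegral_mono fun r => (ℓ (r + t)).le_opENorm _)

theorem inner_sub_inner_eq_intervalIntegral {p : ℝ≥0∞} [Fact (1 ≤ p)] (hℓ : MemLp ℓ p)
    (hx : ∀ P, ∀ t ∈ Icc a b, ⟪x t, ι P⟫_ℝ = ⟪x a, ι P⟫_ℝ + ∫ s in a..t, ℓ s P)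
    {u v : ℝ} (hu : u ∈ Icc a b) (hv : v ∈ Icc a b) (P : V) :
    ⟪x v, ι P⟫_ℝ - ⟪x u, ι P⟫_ℝ = ∫ s in u..v, ℓ s P := by
  rw [hx P v hv, hx P u hu, add_sub_add_left_eq_sub,
    intervalIntegral.integral_interval_sub_left (intervalIntegrable_clm_apply hℓ P a v)
      (intervalIntegrable_clm_apply hℓ P a u)]

theorem enorm_inner_sub_inner_sub_integral_le (hℓ : MemLp ℓ 2) (hm : MemLp m 2) (hX : MemLp X 2)
    (hY : MemLp Y 2)
    (hx : ∀ P, ∀ t ∈ Icc a b, ⟪x t, ι P⟫_ℝ = ⟪x a, ι P⟫_ℝ + ∫ s in a..t, ℓ s P)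
    (hy : ∀ P, ∀ t ∈ Icc a b, ⟪y t, ι P⟫_ℝ = ⟪y a, ι P⟫_ℝ + ∫ s in a..t, m s P)
    {t δ : ℝ} (hδ : 0 ≤ δ) (ht : t ∈ Icc a b) (hδt : δ + t ∈ Icc a b)
    (hXt : ι (X t) = x t) (hYt : ι (Y (δ + t)) = y (δ + t)) :
    ‖⟪x (δ + t), y (δ + t)⟫_ℝ - ⟪x t, y t⟫_ℝ - ∫ s in t..(δ + t), (ℓ s (Y s) + m s (X s))‖ₑ
      ≤ (∫⁻ r in Ioc 0 δ, ‖ℓ (r + t)‖ₑ * ‖Y (δ + t) - Y (r + t)‖ₑ)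
        + ∫⁻ r in Ioc 0 δ, ‖m (r + t)‖ₑ * ‖X (0 + t) - X (r + t)‖ₑ := by
  have hxincr := inner_sub_inner_eq_intervalIntegral hℓ hx ht hδt (Y (δ + t))
  have hyincr := inner_sub_inner_eq_intervalIntegral hm hy ht hδt (X t)
  rw [hYt] at hxincr
  rw [hXt, real_inner_comm, real_inner_comm (x t)] at hyincr
  have hℓY := (integrable_clm_apply hℓ hY).intervalIntegrable (a := t) (b := δ + t)
  have hmX := (integrable_clm_apply hm hX).intervalIntegrable (a := t) (b := δ + t)
  have hsplit : ⟪x (δ + t), y (δ + t)⟫_ℝ - ⟪x t, y t⟫_ℝ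
        - ∫ s in t..(δ + t), (ℓ s (Y s) + m s (X s))
      = (∫ s in t..(δ + t), ℓ s (Y (δ + t) - Y s))
        + ∫ s in t..(δ + t), m s (X (0 + t) - X s) := by
    simp only [map_sub, zero_add]
    rw [intervalIntegral.integral_sub (intervalIntegrable_clm_apply hℓ _ _ _) hℓY,
      intervalIntegral.integral_sub (intervalIntegrable_clm_apply hm _ _ _) hmX,
      intervalIntegral.integral_add hℓY hmX, ← hxincr, ← hyincr]
    ring
  rw [hsplit]
  exact (enorm_add_le _ _).trans (add_le_add (enorm_intervalIntegral_clm_apply_le _ _ hδ)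
    (enorm_intervalIntegral_clm_apply_le _ _ hδ))

theorem lintegral_enorm_inner_sub_inner_sub_integral_le (hℓ : MemLp ℓ 2) (hm : MemLp m 2)
    (hX : MemLp X 2) (hY : MemLp Y 2)
    (hιX : ∀ᵐ t, t ∈ Icc a b → ι (X t) = x t) (hιY : ∀ᵐ t, t ∈ Icc a b → ι (Y t) = y t)
    (hx : ∀ P, ∀ t ∈ Icc a b, ⟪x t, ι P⟫_ℝ = ⟪x a, ι P⟫_ℝ + ∫ s in a..t, ℓ s P)
    (hy : ∀ P, ∀ t ∈ Icc a b, ⟪y t, ι P⟫_ℝ = ⟪y a, ι P⟫_ℝ + ∫ s in a..t, m s P)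
    {δ : ℝ} (hδ : 0 ≤ δ) :
    ∫⁻ t in Ioc a (b - δ), ‖⟪x (δ + t), y (δ + t)⟫_ℝ - ⟪x t, y t⟫_ℝ
        - ∫ s in t..(δ + t), (ℓ s (Y s) + m s (X s))‖ₑ
      ≤ (∫⁻ t, ∫⁻ r in Ioc 0 δ, ‖ℓ (r + t)‖ₑ * ‖Y (δ + t) - Y (r + t)‖ₑ)
        + ∫⁻ t, ∫⁻ r in Ioc 0 δ, ‖m (r + t)‖ₑ * ‖X (0 + t) - X (r + t)‖ₑ := by
  rw [← lintegral_add_left'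
    (aemeasurable_enorm_mul_enorm_translate_sub hℓ.1 hY.1 δ _).lintegral_prod_right']
  refine (lintegral_mono_ae ((ae_restrict_iff' measurableSet_Ioc).2 ?_)).trans
    (setLIntegral_le_lintegral (Ioc a (b - δ)) _)
  filter_upwards [hιX, (quasiMeasurePreserving_add_left volume δ).ae hιY] with t hXt hYt hmem
  have ht : t ∈ Icc a b := ⟨hmem.1.le, by linarith [hmem.2]⟩
  have hδt : δ + t ∈ Icc a b := ⟨by linarith [hmem.1], by linarith [hmem.2]⟩
  exact enorm_inner_sub_inner_sub_integral_le hℓ hm hX hY hx hy hδ ht hδt (hXt ht) (hYt hδt)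

theorem inner_sub_inner_eq_integral_of_memLp (hab : a ≤ b) (hℓ : MemLp ℓ 2) (hm : MemLp m 2)
    (hX : MemLp X 2) (hY : MemLp Y 2)
    (hxc : ContinuousOn x (Icc a b)) (hyc : ContinuousOn y (Icc a b))
    (hιX : ∀ᵐ t, t ∈ Icc a b → ι (X t) = x t) (hιY : ∀ᵐ t, t ∈ Icc a b → ι (Y t) = y t)
    (hx : ∀ P, ∀ t ∈ Icc a b, ⟪x t, ι P⟫_ℝ = ⟪x a, ι P⟫_ℝ + ∫ s in a..t, ℓ s P)
    (hy : ∀ P, ∀ t ∈ Icc a b, ⟪y t, ι P⟫_ℝ = ⟪y a, ι P⟫_ℝ + ∫ s in a..t, m s P) :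
    ⟪x b, y b⟫_ℝ - ⟪x a, y a⟫_ℝ = ∫ s in a..b, (ℓ s (Y s) + m s (X s)) := by
  rcases hab.eq_or_lt with rfl | hab'
  · simp
  have hint (u v : ℝ) : IntervalIntegrable (fun s => ℓ s (Y s) + m s (X s)) volume u v :=
    ((integrable_clm_apply hℓ hY).add (integrable_clm_apply hm hX)).intervalIntegrable
  set Φ : ℝ → ℝ := fun t => ⟪x t, y t⟫_ℝ - ∫ s in a..t, (ℓ s (Y s) + m s (X s)) with hΦ
  have hΦc : ContinuousOn Φ (Icc a b) :=
    (hxc.inner hyc).sub (intervalIntegral.continuous_primitive hint a).continuousOn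
  have hincr (t δ : ℝ) : Φ (δ + t) - Φ t = ⟪x (δ + t), y (δ + t)⟫_ℝ - ⟪x t, y t⟫_ℝ
      - ∫ s in t..(δ + t), (ℓ s (Y s) + m s (X s)) := by
    rw [← intervalIntegral.integral_interval_sub_left (hint a _) (hint a _)]
    simp only [hΦ]
    ring
  suffices Φ b = Φ a by
    simp only [hΦ, intervalIntegral.integral_same] at this
    linarith
  refine eq_of_integral_translate_sub_isLittleO hab hΦc (Asymptotics.isLittleO_iff.2 fun ε hε => ?_)
  filter_upwards [Ioo_mem_nhdsGT (sub_pos.2 hab'),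
    eventually_lintegral_enorm_mul_enorm_translate_sub_le (by simp) hℓ hY (half_pos hε),
    eventually_lintegral_enorm_mul_enorm_translate_sub_le (by simp) hm hX (half_pos hε)]
    with δ hδ hℓδ hmδ
  have hδ₀ : 0 ≤ ε / 2 * δ := mul_nonneg (half_pos hε).le hδ.1.le
  rw [intervalIntegral.integral_of_le (by linarith [hδ.2]), Real.norm_of_nonneg hδ.1.le,
    ← ENNReal.ofReal_le_ofReal_iff (by positivity [hδ.1.le]), ofReal_norm]
  calc ‖∫ t in Ioc a (b - δ), (Φ (δ + t) - Φ t)‖ₑ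
    _ ≤ ∫⁻ t in Ioc a (b - δ), ‖Φ (δ + t) - Φ t‖ₑ := enorm_integral_le_lintegral_enorm _
    _ ≤ ENNReal.ofReal (ε / 2 * δ) + ENNReal.ofReal (ε / 2 * δ) := by
        simp only [hincr]
        exact (lintegral_enorm_inner_sub_inner_sub_integral_le hℓ hm hX hY hιX hιY hx hy
          hδ.1.le).trans (add_le_add (hℓδ δ ⟨hδ.1.le, le_rfl⟩) (hmδ 0 ⟨le_rfl, hδ.1.le⟩))
    _ = ENNReal.ofReal (ε * δ) := by
        rw [← ENNReal.ofReal_add hδ₀ hδ₀]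
        ring_nf

theorem intervalIntegral_indicator_Icc_clm_apply (ℓ : ℝ → V →L[ℝ] ℝ) (P : V) {t : ℝ}
    (ht : t ∈ Icc a b) :
    ∫ s in a..t, (Icc a b).indicator ℓ s P = ∫ s in a..t, ℓ s P := by
  refine intervalIntegral.integral_congr fun s hs => ?_
  rw [uIcc_of_le ht.1] at hs
  have hs' : s ∈ Icc a b := ⟨hs.1, hs.2.trans ht.2⟩
  simp only [indicator_of_mem hs']

theorem inner_sub_inner_eq_integral (hab : a ≤ b) (hℓ : MemLp ℓ 2 (volume.restrict (Icc a b)))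
    (hm : MemLp m 2 (volume.restrict (Icc a b))) (hX : MemLp X 2 (volume.restrict (Icc a b)))
    (hY : MemLp Y 2 (volume.restrict (Icc a b)))
    (hxc : ContinuousOn x (Icc a b)) (hyc : ContinuousOn y (Icc a b))
    (hιX : ∀ᵐ t ∂volume.restrict (Icc a b), ι (X t) = x t)
    (hιY : ∀ᵐ t ∂volume.restrict (Icc a b), ι (Y t) = y t)
    (hx : ∀ P, ∀ t ∈ Icc a b, ⟪x t, ι P⟫_ℝ = ⟪x a, ι P⟫_ℝ + ∫ s in a..t, ℓ s P)
    (hy : ∀ P, ∀ t ∈ Icc a b, ⟪y t, ι P⟫_ℝ = ⟪y a, ι P⟫_ℝ + ∫ s in a..t, m s P) :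
    ⟪x b, y b⟫_ℝ - ⟪x a, y a⟫_ℝ = ∫ s in a..b, (ℓ s (Y s) + m s (X s)) := by
  rw [ae_restrict_iff' measurableSet_Icc] at hιX hιY
  replace hℓ : MemLp ((Icc a b).indicator ℓ) 2 :=
    (memLp_indicator_iff_restrict (ε := V →L[ℝ] ℝ) measurableSet_Icc).2 hℓ
  replace hm : MemLp ((Icc a b).indicator m) 2 :=
    (memLp_indicator_iff_restrict (ε := V →L[ℝ] ℝ) measurableSet_Icc).2 hm
  rw [← memLp_indicator_iff_restrict measurableSet_Icc] at hX hY
  rw [inner_sub_inner_eq_integral_of_memLp (ι := ι) hab hℓ hm hX hY hxc hyc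
    (hιX.mono fun t h ht => by rw [indicator_of_mem ht, h ht])
    (hιY.mono fun t h ht => by rw [indicator_of_mem ht, h ht])
    (fun P t ht => by rw [intervalIntegral_indicator_Icc_clm_apply ℓ P ht, hx P t ht])
    (fun P t ht => by rw [intervalIntegral_indicator_Icc_clm_apply m P ht, hy P t ht])]
  refine intervalIntegral.integral_congr fun s hs => ?_
  rw [uIcc_of_le hab] at hs
  simp only [indicator_of_mem hs]

end IntegrationByParts

/-! ### Uniformly coercive operators -/

section CoerciveOperators

variable {H : Type*} [NormedAddCommGroup H] [InnerProductSpace ℝ H]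

theorem apply_inverse_apply {R V : Type*} [Ring R] [TopologicalSpace V] [AddCommGroup V]
    [IsTopologicalAddGroup V] [Module R V] {T : V →L[R] V} (hT : IsUnit T) (u : V) :
    T (Ring.inverse T u) = u := by
  simpa using DFunLike.congr_fun (Ring.mul_inverse_cancel T hT) u

theorem inverse_apply_apply {R V : Type*} [Ring R] [TopologicalSpace V] [AddCommGroup V]
    [IsTopologicalAddGroup V] [Module R V] {T : V →L[R] V} (hT : IsUnit T) (u : V) :
    Ring.inverse T (T u) = u := by
  simpa using DFunLike.congr_fun (Ring.inverse_mul_cancel T hT) u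

theorem inner_inverse_left_of_symm {T : H →L[ℝ] H} (hT : IsUnit T)
    (hsymm : ∀ u v, ⟪T u, v⟫_ℝ = ⟪u, T v⟫_ℝ) (u v : H) :
    ⟪Ring.inverse T u, v⟫_ℝ = ⟪u, Ring.inverse T v⟫_ℝ := by
  conv_lhs => rw [← apply_inverse_apply hT v, ← hsymm, apply_inverse_apply hT]

theorem isUnit_of_coercive [CompleteSpace H] {T : H →L[ℝ] H} {c : ℝ} (hc : 0 < c)
    (hT : ∀ u, c * ‖u‖ ^ 2 ≤ ⟪u, T u⟫_ℝ) : IsUnit T := by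
  refine T.isUnit_of_forall_le_norm_inner_map (c := ⟨c, hc.le⟩) hc fun u => ?_
  rw [real_inner_comm, mul_comm]
  exact (hT u).trans (le_abs_self _)

theorem inverse_coercive {T : H →L[ℝ] H} (hunit : IsUnit T) {c K : ℝ} (hc : 0 ≤ c) (hK : 0 < K)
    (hTK : ‖T‖ ≤ K) (hT : ∀ u, c * ‖u‖ ^ 2 ≤ ⟪u, T u⟫_ℝ) (u : H) :
    c / K ^ 2 * ‖u‖ ^ 2 ≤ ⟪u, Ring.inverse T u⟫_ℝ := by
  have hu : ‖u‖ ≤ K * ‖Ring.inverse T u‖ := by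
    simpa only [apply_inverse_apply hunit] using T.le_of_opNorm_le hTK (Ring.inverse T u)
  calc c / K ^ 2 * ‖u‖ ^ 2
    _ ≤ c / K ^ 2 * (K * ‖Ring.inverse T u‖) ^ 2 := by gcongr
    _ = c * ‖Ring.inverse T u‖ ^ 2 := by field_simp
    _ ≤ ⟪Ring.inverse T u, T (Ring.inverse T u)⟫_ℝ := hT _
    _ = ⟪u, Ring.inverse T u⟫_ℝ := by rw [apply_inverse_apply hunit, real_inner_comm]

end CoerciveOperators

section MultiplicationOperators

variable {α : Type*} [MeasurableSpace α] {μ : Measure α}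

theorem aestronglyMeasurable_clm_apply {E F : Type*} [NormedAddCommGroup E] [NormedSpace ℝ E]
    [NormedAddCommGroup F] [NormedSpace ℝ F] {T : α → E →L[ℝ] F}
    (hT : ∀ v, AEStronglyMeasurable (fun t => T t v) μ) {f : α → E}
    (hf : AEStronglyMeasurable f μ) : AEStronglyMeasurable (fun t => T t (f t)) μ := by
  suffices AEStronglyMeasurable (fun t => T t (hf.mk f t)) μ from
    this.congr (hf.ae_eq_mk.mono fun t ht => congrArg (T t) ht.symm)
  let g := hf.stronglyMeasurable_mk.approx
  have hsum (n : ℕ) : (fun t => T t (g n t))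
      = fun t => ∑ v ∈ (g n).range, (g n ⁻¹' {v}).indicator (fun t => T t v) t := by
    funext t
    rw [Finset.sum_eq_single (g n t) (fun v _ hv => indicator_of_notMem (fun h => hv h.symm) _)
      (fun h => absurd (SimpleFunc.mem_range_self _ _) h)]
    exact (indicator_of_mem rfl _).symm
  refine aestronglyMeasurable_of_tendsto_ae atTop (f := fun n t => T t (g n t)) (fun n => ?_)
    (.of_forall fun t => ((T t).continuous.tendsto _).comp
      (hf.stronglyMeasurable_mk.tendsto_approx t))
  rw [hsum]
  exact Finset.aestronglyMeasurable_fun_sum _ fun v _ =>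
    (hT v).indicator ((g n).measurableSet_preimage _)

theorem exists_Lp_clm_ae_eq_apply {E F : Type*} [NormedAddCommGroup E] [NormedSpace ℝ E]
    [NormedAddCommGroup F] [NormedSpace ℝ F] (p : ℝ≥0∞) [Fact (1 ≤ p)] {T : α → E →L[ℝ] F} {K : ℝ}
    (hT : ∀ v, AEStronglyMeasurable (fun t => T t v) μ) (hK : ∀ᵐ t ∂μ, ‖T t‖ ≤ K) :
    ∃ M : Lp E p μ →L[ℝ] Lp F p μ, ∀ u, ∀ᵐ t ∂μ, M u t = T t (u t) := by
  have hbound (u : α → E) : ∀ᵐ t ∂μ, ‖T t (u t)‖ ≤ K * ‖u t‖ :=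
    hK.mono fun t ht => (T t).le_of_opNorm_le ht _
  have hmem (u : Lp E p μ) : MemLp (fun t => T t (u t)) p μ :=
    (Lp.memLp u).of_le_mul (aestronglyMeasurable_clm_apply hT (Lp.aestronglyMeasurable u))
      (hbound u)
  let M : Lp E p μ →ₗ[ℝ] Lp F p μ :=
    { toFun := fun u => (hmem u).toLp _
      map_add' := fun u v => by
        rw [← MemLp.toLp_add, MemLp.toLp_eq_toLp_iff]
        filter_upwards [Lp.coeFn_add u v] with t ht
        simp only [ht, Pi.add_apply, map_add]
      map_smul' := fun r u => by
        rw [RingHom.id_apply, ← MemLp.toLp_const_smul, MemLp.toLp_eq_toLp_iff]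
        filter_upwards [Lp.coeFn_smul r u] with t ht
        simp only [ht, Pi.smul_apply, map_smul] }
  refine ⟨M.mkContinuous K fun u => Lp.norm_le_mul_norm_of_ae_le_mul ?_,
    fun u => (hmem u).coeFn_toLp⟩
  filter_upwards [(hmem u).coeFn_toLp, hbound u] with t ht hle
  exact (congrArg norm ht).trans_le hle

variable {H : Type*} [NormedAddCommGroup H] [InnerProductSpace ℝ H]

theorem coercive_of_ae_coercive {T : α → H →L[ℝ] H} {M : Lp H 2 μ →L[ℝ] Lp H 2 μ} {c : ℝ}
    (hM : ∀ u, ∀ᵐ t ∂μ, M u t = T t (u t)) (hT : ∀ᵐ t ∂μ, ∀ u, c * ‖u‖ ^ 2 ≤ ⟪u, T t u⟫_ℝ)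
    (u : Lp H 2 μ) : c * ‖u‖ ^ 2 ≤ ⟪u, M u⟫_ℝ := by
  rw [← real_inner_self_eq_norm_sq, L2.inner_def, L2.inner_def, ← integral_const_mul]
  refine integral_mono_ae ((L2.integrable_inner u u).const_mul c) (L2.integrable_inner u (M u)) ?_
  filter_upwards [hM u, hT] with t hMt hTt
  rw [hMt, real_inner_self_eq_norm_sq]
  exact hTt (u t)

theorem exists_Lp_clm_ae_eq_inverse_apply [CompleteSpace H] {T : α → H →L[ℝ] H} {c K : ℝ}
    (hc : 0 < c) (hmeas : ∀ v, AEStronglyMeasurable (fun t => T t v) μ)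
    (hK : ∀ᵐ t ∂μ, ‖T t‖ ≤ K) (hT : ∀ᵐ t ∂μ, ∀ u, c * ‖u‖ ^ 2 ≤ ⟪u, T t u⟫_ℝ) :
    ∃ M : Lp H 2 μ →L[ℝ] Lp H 2 μ, ∀ u, ∀ᵐ t ∂μ, M u t = Ring.inverse (T t) (u t) := by
  obtain ⟨N, hN⟩ := exists_Lp_clm_ae_eq_apply 2 hmeas hK
  refine ⟨Ring.inverse N, fun u => ?_⟩
  have hunit : IsUnit N := isUnit_of_coercive hc (coercive_of_ae_coercive hN hT)
  filter_upwards [hN (Ring.inverse N u), hT] with t hNt hTt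
  rw [apply_inverse_apply hunit] at hNt
  rw [hNt, inverse_apply_apply (isUnit_of_coercive hc hTt)]

end MultiplicationOperators

section BlockDiagonal

variable {E F : Type*} [NormedAddCommGroup E] [InnerProductSpace ℝ E] [NormedAddCommGroup F]
  [InnerProductSpace ℝ F]

/-- The block diagonal operator `diag(S, T)` on the Hilbert sum of two spaces, as in
`L_UU = diag(L_{U_d U_d}, L_{U_b U_b})`. -/
noncomputable def blockDiag (S : E →L[ℝ] E) (T : F →L[ℝ] F) :
    WithLp 2 (E × F) →L[ℝ] WithLp 2 (E × F) :=
  (WithLp.prodContinuousLinearEquiv 2 ℝ E F).symm.toContinuousLinearMap.comp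
    ((S.prodMap T).comp (WithLp.prodContinuousLinearEquiv 2 ℝ E F).toContinuousLinearMap)

theorem inner_blockDiag (S : E →L[ℝ] E) (T : F →L[ℝ] F) (u v : WithLp 2 (E × F)) :
    ⟪u, blockDiag S T v⟫_ℝ = ⟪u.fst, S v.fst⟫_ℝ + ⟪u.snd, T v.snd⟫_ℝ := rfl

theorem blockDiag_symm {S : E →L[ℝ] E} {T : F →L[ℝ] F} (hS : ∀ u v, ⟪S u, v⟫_ℝ = ⟪u, S v⟫_ℝ)
    (hT : ∀ u v, ⟪T u, v⟫_ℝ = ⟪u, T v⟫_ℝ) (u v : WithLp 2 (E × F)) :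
    ⟪blockDiag S T u, v⟫_ℝ = ⟪u, blockDiag S T v⟫_ℝ := by
  rw [real_inner_comm, inner_blockDiag, inner_blockDiag, real_inner_comm, hS,
    real_inner_comm _ v.snd, hT]

theorem blockDiag_coercive {S : E →L[ℝ] E} {T : F →L[ℝ] F} {a b : ℝ}
    (hS : ∀ u, a * ‖u‖ ^ 2 ≤ ⟪u, S u⟫_ℝ) (hT : ∀ u, b * ‖u‖ ^ 2 ≤ ⟪u, T u⟫_ℝ)
    (u : WithLp 2 (E × F)) : min a b * ‖u‖ ^ 2 ≤ ⟪u, blockDiag S T u⟫_ℝ := by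
  rw [inner_blockDiag, WithLp.prod_norm_sq_eq_of_L2, mul_add]
  exact add_le_add
    ((mul_le_mul_of_nonneg_right (min_le_left a b) (sq_nonneg _)).trans (hS u.fst))
    ((mul_le_mul_of_nonneg_right (min_le_right a b) (sq_nonneg _)).trans (hT u.snd))

theorem norm_blockDiag_le {S : E →L[ℝ] E} {T : F →L[ℝ] F} {K : ℝ} (hS : ‖S‖ ≤ K)
    (hT : ‖T‖ ≤ K) : ‖blockDiag S T‖ ≤ K := by
  have hK : 0 ≤ K := (norm_nonneg _).trans hS
  refine ContinuousLinearMap.opNorm_le_bound _ hK fun u => ?_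
  rw [← sq_le_sq₀ (norm_nonneg _) (by positivity), mul_pow, WithLp.prod_norm_sq_eq_of_L2,
    WithLp.prod_norm_sq_eq_of_L2, mul_add, ← mul_pow, ← mul_pow]
  gcongr
  exacts [S.le_of_opNorm_le hS _, T.le_of_opNorm_le hT _]

theorem inverse_blockDiag {S : E →L[ℝ] E} {T : F →L[ℝ] F} (hS : IsUnit S) (hT : IsUnit T) :
    Ring.inverse (blockDiag S T) = blockDiag (Ring.inverse S) (Ring.inverse T) :=
  Ring.inverse_unit (⟨blockDiag S T, blockDiag (Ring.inverse S) (Ring.inverse T),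
    ContinuousLinearMap.ext fun u =>
      congrArg (WithLp.toLp 2) <|
        Prod.ext (apply_inverse_apply hS u.fst) (apply_inverse_apply hT u.snd),
    ContinuousLinearMap.ext fun u =>
      congrArg (WithLp.toLp 2) <|
        Prod.ext (inverse_apply_apply hS u.fst) (inverse_apply_apply hT u.snd)⟩ :
    (_)ˣ)

end BlockDiagonal

section ControlHessian

variable {d : ℕ} {D Γ : Set (Euc d)} {n k l : ℕ} {A : Derivs D Γ n k l} {t₀ tf : ℝ}

/-- `L_UU = diag(L_{U_d U_d}, L_{U_b U_b})`, the second derivative of the running cost in the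
stacked control. -/
noncomputable def Derivs.LUU (A : Derivs D Γ n k l) (t : ℝ) : Ctrl D k l →L[ℝ] Ctrl D k l :=
  blockDiag (A.LUdUd t) (A.LUbUb t)

namespace Derivs.Regular

theorem isUnit_LUdUd (hA : A.Regular t₀ tf) {t : ℝ} (ht : t ∈ Icc t₀ tf) :
    IsUnit (A.LUdUd t) :=
  let ⟨_, hc, hpos⟩ := hA.pos_d
  isUnit_of_coercive hc (hpos t ht)

theorem isUnit_LUbUb (hA : A.Regular t₀ tf) {t : ℝ} (ht : t ∈ Icc t₀ tf) :
    IsUnit (A.LUbUb t) :=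
  let ⟨_, hc, hpos⟩ := hA.pos_b
  isUnit_of_coercive hc (hpos t ht)

theorem invd_symm (hA : A.Regular t₀ tf) {t : ℝ} (ht : t ∈ Icc t₀ tf) (u v : L2D D k) :
    ⟪A.invd t u, v⟫_ℝ = ⟪u, A.invd t v⟫_ℝ :=
  inner_inverse_left_of_symm (hA.isUnit_LUdUd ht) (hA.symm_d t ht) u v

theorem invb_symm (hA : A.Regular t₀ tf) {t : ℝ} (ht : t ∈ Icc t₀ tf) (u v : L2S D l) :
    ⟪A.invb t u, v⟫_ℝ = ⟪u, A.invb t v⟫_ℝ :=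
  inner_inverse_left_of_symm (hA.isUnit_LUbUb ht) (hA.symm_b t ht) u v

theorem inverse_LUU (hA : A.Regular t₀ tf) {t : ℝ} (ht : t ∈ Icc t₀ tf) :
    Ring.inverse (A.LUU t) = blockDiag (A.invd t) (A.invb t) :=
  inverse_blockDiag (hA.isUnit_LUdUd ht) (hA.isUnit_LUbUb ht)

theorem exists_coercive_LUU (hA : A.Regular t₀ tf) :
    ∃ c > 0, ∀ t ∈ Icc t₀ tf, ∀ u, c * ‖u‖ ^ 2 ≤ ⟪u, A.LUU t u⟫_ℝ := by
  obtain ⟨a, ha, hd⟩ := hA.pos_d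
  obtain ⟨b, hb, hb'⟩ := hA.pos_b
  exact ⟨min a b, lt_min ha hb, fun t ht => blockDiag_coercive (hd t ht) (hb' t ht)⟩

theorem exists_norm_LUU_le (hA : A.Regular t₀ tf) :
    ∃ K > 0, ∀ t ∈ Icc t₀ tf, ‖A.LUU t‖ ≤ K := by
  obtain ⟨Kd, hd⟩ := hA.bdd_d
  obtain ⟨Kb, hb⟩ := hA.bdd_b
  refine ⟨max 1 (max Kd Kb), zero_lt_one.trans_le (le_max_left _ _), fun t ht => ?_⟩
  exact norm_blockDiag_le ((hd t ht).trans ((le_max_left _ _).trans (le_max_right _ _)))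
    ((hb t ht).trans ((le_max_right _ _).trans (le_max_right _ _)))

theorem isUnit_LUU (hA : A.Regular t₀ tf) {t : ℝ} (ht : t ∈ Icc t₀ tf) : IsUnit (A.LUU t) :=
  let ⟨_, hc, hpos⟩ := hA.exists_coercive_LUU
  isUnit_of_coercive hc (hpos t ht)

theorem LUU_symm (hA : A.Regular t₀ tf) {t : ℝ} (ht : t ∈ Icc t₀ tf) (u v : Ctrl D k l) :
    ⟪A.LUU t u, v⟫_ℝ = ⟪u, A.LUU t v⟫_ℝ :=
  blockDiag_symm (hA.symm_d t ht) (hA.symm_b t ht) u v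

theorem inverse_LUU_symm (hA : A.Regular t₀ tf) {t : ℝ} (ht : t ∈ Icc t₀ tf) (u v : Ctrl D k l) :
    ⟪Ring.inverse (A.LUU t) u, v⟫_ℝ = ⟪u, Ring.inverse (A.LUU t) v⟫_ℝ :=
  inner_inverse_left_of_symm (hA.isUnit_LUU ht) (fun _ _ => hA.LUU_symm ht _ _) u v

theorem exists_coercive_inverse_LUU (hA : A.Regular t₀ tf) :
    ∃ c > 0, ∀ t ∈ Icc t₀ tf, ∀ u, c * ‖u‖ ^ 2 ≤ ⟪u, Ring.inverse (A.LUU t) u⟫_ℝ := by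
  obtain ⟨c, hc, hpos⟩ := hA.exists_coercive_LUU
  obtain ⟨K, hK, hbdd⟩ := hA.exists_norm_LUU_le
  exact ⟨c / K ^ 2, by positivity, fun t ht =>
    inverse_coercive (hA.isUnit_LUU ht) hc.le hK (hbdd t ht) (hpos t ht)⟩

theorem aestronglyMeasurable_LUU_apply (hA : A.Regular t₀ tf) (u : Ctrl D k l) :
    AEStronglyMeasurable (fun t => A.LUU t u) (timeMeasure t₀ tf) :=
  (WithLp.prod_continuous_toLp 2 (L2D D k) (L2S D l)).comp_aestronglyMeasurable
    ((hA.meas_d u.fst).prodMk (hA.meas_b u.snd))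

theorem exists_Lp_inverse_LUU (hA : A.Regular t₀ tf) :
    ∃ M : Lp (Ctrl D k l) 2 (timeMeasure t₀ tf) →L[ℝ] Lp (Ctrl D k l) 2 (timeMeasure t₀ tf),
      ∀ u, ∀ᵐ t ∂timeMeasure t₀ tf, M u t = Ring.inverse (A.LUU t) (u t) := by
  obtain ⟨c, hc, hpos⟩ := hA.exists_coercive_LUU
  obtain ⟨K, -, hbdd⟩ := hA.exists_norm_LUU_le
  exact exists_Lp_clm_ae_eq_inverse_apply hc hA.aestronglyMeasurable_LUU_apply
    (ae_restrict_of_forall_mem measurableSet_Icc hbdd)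
    (ae_restrict_of_forall_mem measurableSet_Icc hpos)

theorem inner_QU_eq_integral (hA : A.Regular t₀ tf) (h₀ : t₀ ≤ tf) {VX : Path D Γ n}
    (hQ : MemLp (A.QU VX) 2 (timeMeasure t₀ tf))
    {M : Lp (Ctrl D k l) 2 (timeMeasure t₀ tf) →L[ℝ] Lp (Ctrl D k l) 2 (timeMeasure t₀ tf)}
    (hM : ∀ u, ∀ᵐ t ∂timeMeasure t₀ tf, M u t = Ring.inverse (A.LUU t) (u t)) :
    ⟪hQ.toLp (A.QU VX), M (hQ.toLp (A.QU VX))⟫_ℝ = ∫ t in t₀..tf,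
      (⟪A.Qd VX t, A.invd t (A.Qd VX t)⟫_ℝ + ⟪A.Qb VX t, A.invb t (A.Qb VX t)⟫_ℝ) := by
  rw [L2.inner_def, intervalIntegral.integral_of_le h₀, ← integral_Icc_eq_integral_Ioc]
  refine integral_congr_ae ?_
  filter_upwards [hM (hQ.toLp (A.QU VX)), hQ.coeFn_toLp, ae_restrict_mem measurableSet_Icc]
    with t hMt hQt ht
  rw [hMt, hQt, hA.inverse_LUU ht, inner_blockDiag]
  rfl

theorem inner_Lp_inverse_LUU_pos (hA : A.Regular t₀ tf)
    {M : Lp (Ctrl D k l) 2 (timeMeasure t₀ tf) →L[ℝ] Lp (Ctrl D k l) 2 (timeMeasure t₀ tf)}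
    (hM : ∀ u, ∀ᵐ t ∂timeMeasure t₀ tf, M u t = Ring.inverse (A.LUU t) (u t))
    {u : Lp (Ctrl D k l) 2 (timeMeasure t₀ tf)} (hu : u ≠ 0) : 0 < ⟪u, M u⟫_ℝ := by
  obtain ⟨c, hc, hpos⟩ := hA.exists_coercive_inverse_LUU
  have hcoer := coercive_of_ae_coercive hM (ae_restrict_of_forall_mem measurableSet_Icc hpos) u
  have : 0 < ‖u‖ := norm_pos_iff.mpr hu
  exact lt_of_lt_of_le (by positivity) hcoer

end Derivs.Regular

end ControlHessian

/-! ### Paths and weak time derivatives -/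

-- Shortcut instances: unifying norms on `fieldSpace D Γ n` is prohibitively slow without them.
noncomputable local instance {d : ℕ} {D Γ : Set (Euc d)} {n : ℕ} :
    NormedAddCommGroup (fieldSpace D Γ n) := Submodule.normedAddCommGroup _
noncomputable local instance {d : ℕ} {D Γ : Set (Euc d)} {n : ℕ} :
    NormedSpace ℝ (fieldSpace D Γ n) := Submodule.normedSpace _

section Paths

variable {d : ℕ} {D Γ : Set (Euc d)} {n : ℕ} {t₀ tf : ℝ} {x y : Path D Γ n}

instance : IsFiniteMeasure (timeMeasure t₀ tf) := by
  unfold timeMeasure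
  infer_instance

theorem intervalIntegrable_iff_integrable_timeMeasure {E : Type*} [NormedAddCommGroup E]
    (h₀ : t₀ ≤ tf) {f : ℝ → E} :
    IntervalIntegrable f volume t₀ tf ↔ Integrable f (timeMeasure t₀ tf) :=
  intervalIntegrable_iff_integrableOn_Icc_of_le h₀

theorem intervalIntegrable_inner {E : Type*} [NormedAddCommGroup E] [InnerProductSpace ℝ E]
    (h₀ : t₀ ≤ tf) {f g : ℝ → E} (hf : MemLp f 2 (timeMeasure t₀ tf))
    (hg : MemLp g 2 (timeMeasure t₀ tf)) :
    IntervalIntegrable (fun t => ⟪f t, g t⟫_ℝ) volume t₀ tf :=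
  (intervalIntegrable_iff_integrable_timeMeasure h₀).2 <|
    integrable_clm_apply ((innerSL ℝ).comp_memLp' hf) hg

theorem toReal_eLpNorm_const_smul {E : Type*} [NormedAddCommGroup E] [NormedSpace ℝ E] {α : Type*}
    [MeasurableSpace α] {μ : Measure α} (p : ℝ≥0∞) (c : ℝ) (f : α → E) :
    (eLpNorm (fun t => c • f t) p μ).toReal = |c| * (eLpNorm f p μ).toReal := by
  rw [← Real.norm_eq_abs, ← toReal_enorm, ← ENNReal.toReal_mul, ← eLpNorm_const_smul]
  rfl

theorem toReal_eLpNorm_add_le {E : Type*} [NormedAddCommGroup E] {α : Type*} [MeasurableSpace α]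
    {μ : Measure α} {p : ℝ≥0∞} (hp : 1 ≤ p) {f g : α → E} (hf : MemLp f p μ) (hg : MemLp g p μ) :
    (eLpNorm (fun t => f t + g t) p μ).toReal
      ≤ (eLpNorm f p μ).toReal + (eLpNorm g p μ).toReal := by
  rw [toReal_eLpNorm hf.1, toReal_eLpNorm hg.1]
  exact (toReal_eLpNorm (hf.add hg).1).trans_le (lpNorm_add_le hf hp)

theorem pathNorm_nonneg (x : Path D Γ n) : 0 ≤ pathNorm t₀ tf x :=
  add_nonneg (Real.sSup_nonneg (forall_mem_image.2 fun _ _ => norm_nonneg _))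
    ENNReal.toReal_nonneg

open scoped Pointwise in
theorem pathNorm_smul (c : ℝ) (x : Path D Γ n) :
    pathNorm t₀ tf (c • x) = |c| * pathNorm t₀ tf x := by
  have hsup : sSup ((fun t => ‖((c • x) t).1‖) '' Icc t₀ tf)
      = |c| * sSup ((fun t => ‖(x t).1‖) '' Icc t₀ tf) := by
    rw [← smul_eq_mul, ← Real.sSup_smul_of_nonneg (abs_nonneg c), ← image_smul, image_image]
    exact congrArg sSup (image_congr fun t _ => norm_smul c (x t).1)
  have hLp : (eLpNorm (fun t => ((c • x) t).2) 2 (timeMeasure t₀ tf)).toReal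
      = |c| * (eLpNorm (fun t => (x t).2) 2 (timeMeasure t₀ tf)).toReal := by
    simp only [Pi.smul_apply, Prod.smul_snd]
    exact toReal_eLpNorm_const_smul 2 c _
  exact (congrArg₂ (· + ·) hsup hLp).trans (mul_add _ _ _).symm

theorem pathNorm_zero : pathNorm t₀ tf (0 : Path D Γ n) = 0 := by
  rw [← zero_smul ℝ (0 : Path D Γ n), pathNorm_smul, abs_zero, zero_mul]

namespace IsPath

theorem sub (hx : IsPath t₀ tf x) (hy : IsPath t₀ tf y) : IsPath t₀ tf (x - y) where
  cont := hx.cont.sub hy.cont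
  memLp := hx.memLp.sub hy.memLp
  val_eq := by
    filter_upwards [hx.val_eq, hy.val_eq] with t hxt hyt
    exact (map_sub val _ _).trans (congrArg₂ _ hxt hyt)

theorem const_smul (hx : IsPath t₀ tf x) (c : ℝ) : IsPath t₀ tf (c • x) where
  cont := hx.cont.const_smul c
  memLp := hx.memLp.const_smul c
  val_eq := hx.val_eq.mono fun _ ht =>
    (val.map_smul c _).trans (congrArg (c • ·) ht)

theorem memLp_fst (hx : IsPath t₀ tf x) : MemLp (fun t => (x t).1) 2 (timeMeasure t₀ tf) :=
  ((val : fieldSpace D Γ n →L[ℝ] L2D D n).comp_memLp' hx.memLp).ae_eq hx.val_eq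

theorem norm_le_sSup (hx : IsPath t₀ tf x) {t : ℝ} (ht : t ∈ Icc t₀ tf) :
    ‖(x t).1‖ ≤ sSup ((fun t => ‖(x t).1‖) '' Icc t₀ tf) :=
  le_csSup (isCompact_Icc.bddAbove_image hx.cont.norm) (mem_image_of_mem _ ht)

theorem norm_le_pathNorm (hx : IsPath t₀ tf x) {t : ℝ} (ht : t ∈ Icc t₀ tf) :
    ‖(x t).1‖ ≤ pathNorm t₀ tf x :=
  (hx.norm_le_sSup ht).trans (le_add_of_nonneg_right ENNReal.toReal_nonneg)

theorem pathNorm_add_le (h₀ : t₀ ≤ tf) (hx : IsPath t₀ tf x) (hy : IsPath t₀ tf y) :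
    pathNorm t₀ tf (x + y) ≤ pathNorm t₀ tf x + pathNorm t₀ tf y := by
  have hsup : sSup ((fun t => ‖((x + y) t).1‖) '' Icc t₀ tf)
      ≤ sSup ((fun t => ‖(x t).1‖) '' Icc t₀ tf) + sSup ((fun t => ‖(y t).1‖) '' Icc t₀ tf) :=
    csSup_le ((nonempty_Icc.2 h₀).image _) <| forall_mem_image.2 fun t ht =>
      (norm_add_le (x t).1 (y t).1).trans (add_le_add (hx.norm_le_sSup ht) (hy.norm_le_sSup ht))
  have hLp : (eLpNorm (fun t => ((x + y) t).2) 2 (timeMeasure t₀ tf)).toReal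
      ≤ (eLpNorm (fun t => (x t).2) 2 (timeMeasure t₀ tf)).toReal
        + (eLpNorm (fun t => (y t).2) 2 (timeMeasure t₀ tf)).toReal :=
    toReal_eLpNorm_add_le one_le_two hx.memLp hy.memLp
  exact (add_le_add hsup hLp).trans_eq (add_add_add_comm _ _ _ _)

end IsPath

theorem intervalIntegrable_clm_apply_const {E : Type*} [NormedAddCommGroup E]
    [NormedSpace ℝ E] {ℓ : ℝ → E →L[ℝ] ℝ} (hℓ : MemLp ℓ 2 (timeMeasure t₀ tf)) (v : E)
    {t : ℝ} (ht : t ∈ Icc t₀ tf) : IntervalIntegrable (fun s => ℓ s v) volume t₀ t :=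
  IntervalIntegrable.mono_set
    ((intervalIntegrable_iff_integrable_timeMeasure (ht.1.trans ht.2)).2
      (((ContinuousLinearMap.apply ℝ ℝ v).comp_memLp' hℓ).integrable one_le_two))
    (by rw [uIcc_of_le ht.1, uIcc_of_le (ht.1.trans ht.2)]; exact Icc_subset_Icc_right ht.2)

namespace HasWeakTimeDeriv

variable {ℓ m : ℝ → (fieldSpace D Γ n →L[ℝ] ℝ)}

theorem sub (hx : HasWeakTimeDeriv t₀ tf x ℓ) (hy : HasWeakTimeDeriv t₀ tf y m) :
    HasWeakTimeDeriv t₀ tf (x - y) (ℓ - m) where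
  isPath := hx.isPath.sub hy.isPath
  memLp := hx.memLp.sub hy.memLp
  eq P t ht := by
    have hint : ∫ s in t₀..t, (ℓ - m) s P = (∫ s in t₀..t, ℓ s P) - ∫ s in t₀..t, m s P :=
      intervalIntegral.integral_sub (intervalIntegrable_clm_apply_const hx.memLp P ht)
        (intervalIntegrable_clm_apply_const hy.memLp P ht)
    have hleft (s : ℝ) : ⟪((x - y) s).1, val P⟫_ℝ = ⟪(x s).1, val P⟫_ℝ - ⟪(y s).1, val P⟫_ℝ :=
      inner_sub_left (x s).1 (y s).1 (val P)
    linear_combination hleft t - hleft t₀ + hx.eq P t ht - hy.eq P t ht - hint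

theorem const_smul (hx : HasWeakTimeDeriv t₀ tf x ℓ) (c : ℝ) :
    HasWeakTimeDeriv t₀ tf (c • x) (c • ℓ) where
  isPath := hx.isPath.const_smul c
  memLp := hx.memLp.const_smul c
  eq P t ht := by
    have hint : ∫ s in t₀..t, (c • ℓ) s P = c * ∫ s in t₀..t, ℓ s P :=
      intervalIntegral.integral_const_mul c fun s => ℓ s P
    have hleft (s : ℝ) : ⟪((c • x) s).1, val P⟫_ℝ = c * ⟪(x s).1, val P⟫_ℝ :=
      real_inner_smul_left (x s).1 (val P) c
    linear_combination hleft t - hleft t₀ + c * hx.eq P t ht - hint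

theorem intervalIntegrable_apply (h₀ : t₀ ≤ tf) (hx : HasWeakTimeDeriv t₀ tf x ℓ)
    (hy : IsPath t₀ tf y) : IntervalIntegrable (fun t => ℓ t (y t).2) volume t₀ tf :=
  (intervalIntegrable_iff_integrable_timeMeasure h₀).2 (integrable_clm_apply hx.memLp hy.memLp)

theorem inner_sub_inner (h₀ : t₀ ≤ tf) (hx : HasWeakTimeDeriv t₀ tf x ℓ)
    (hy : HasWeakTimeDeriv t₀ tf y m) :
    ⟪(x tf).1, (y tf).1⟫_ℝ - ⟪(x t₀).1, (y t₀).1⟫_ℝ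
      = ∫ s in t₀..tf, (ℓ s (y s).2 + m s (x s).2) :=
  inner_sub_inner_eq_integral h₀ hx.memLp hy.memLp hx.isPath.memLp
    hy.isPath.memLp hx.isPath.cont hy.isPath.cont hx.isPath.val_eq hy.isPath.val_eq hx.eq hy.eq

theorem inner_add_integral_eq (h₀ : t₀ ≤ tf) (hx : HasWeakTimeDeriv t₀ tf x ℓ)
    (hy : HasWeakTimeDeriv t₀ tf y m) (hy₀ : (y t₀).1 = 0) {f g : ℝ → ℝ}
    (hf : IntervalIntegrable f volume t₀ tf)
    (hfg : ∀ᵐ t ∂timeMeasure t₀ tf, ℓ t (y t).2 + m t (x t).2 + f t = g t) :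
    ⟪(x tf).1, (y tf).1⟫_ℝ + ∫ t in t₀..tf, f t = ∫ t in t₀..tf, g t := by
  have hinit : ⟪(x t₀).1, (y t₀).1⟫_ℝ = 0 :=
    (congrArg (inner ℝ (x t₀).1) hy₀).trans (inner_zero_right _)
  have hadd := intervalIntegral.integral_add ((hx.intervalIntegrable_apply h₀ hy.isPath).add
    (hy.intervalIntegrable_apply h₀ hx.isPath)) hf
  have hcongr : ∫ t in t₀..tf, (ℓ t (y t).2 + m t (x t).2 + f t) = ∫ t in t₀..tf, g t := by
    refine intervalIntegral.integral_congr_ae_restrict ?_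
    rw [uIoc_of_le h₀]
    exact ae_restrict_of_ae_restrict_of_subset Ioc_subset_Icc_self hfg
  linear_combination hx.inner_sub_inner h₀ hy + hinit - hadd + hcongr

end HasWeakTimeDeriv

end Paths

section WeakForms

variable {d : ℕ} {D Γ : Set (Euc d)} {n k l : ℕ}

theorem map_sub_smul {E F : Type*} [NormedAddCommGroup E] [NormedSpace ℝ E]
    [NormedAddCommGroup F] [NormedSpace ℝ F] (T : E →L[ℝ] F) (c : ℝ) (u v : E) :
    T (u - c • v) = T u - c • T v := by
  rw [map_sub, map_smul]

theorem weakForm_apply (a : Fin d → L2D D n) (f : L2D D n) (g : L2S D n)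
    (P : fieldSpace D Γ n) :
    weakForm a f g P = -∑ i, ⟪a i, grad i P⟫_ℝ + ⟪f, val P⟫_ℝ - ⟪g, tr P⟫_ℝ := by
  simp [weakForm]

theorem weakForm_sub_smul (c : ℝ) (a a' : Fin d → L2D D n) (f f' : L2D D n) (g g' : L2S D n) :
    (weakForm (a - c • a') (f - c • f') (g - c • g') : fieldSpace D Γ n →L[ℝ] ℝ)
      = weakForm a f g - c • weakForm a' f' g' := by
  ext P
  change _ = weakForm a f g P - c * weakForm a' f' g' P
  simp only [weakForm_apply, Pi.sub_apply, Pi.smul_apply, inner_sub_left, real_inner_smul_left,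
    Finset.sum_sub_distrib, ← Finset.mul_sum]
  ring

theorem adjointForm_apply (aX : fieldSpace D Γ n →L[ℝ] (Fin d → L2D D n))
    (fX : fieldSpace D Γ n →L[ℝ] L2D D n) (gX : fieldSpace D Γ n →L[ℝ] L2S D n)
    (q P : fieldSpace D Γ n) :
    adjointForm aX fX gX q P = weakForm (aX P) (fX P) (gX P) q := by
  simp only [weakForm_apply, fun i => real_inner_comm (grad i q) (aX P i),
    real_inner_comm (val q), real_inner_comm (tr q)]
  simp [adjointForm]

/-- The weak form of the linear pair `(F_X h + F_{U_d} v, N_X h + N_{U_b} w)` at time `t`. -/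
noncomputable def Derivs.linearised (A : Derivs D Γ n k l) (t : ℝ) (h : fieldSpace D Γ n)
    (v : L2D D k) (w : L2S D l) : fieldSpace D Γ n →L[ℝ] ℝ :=
  weakForm (A.aX t h) (A.fX t h + A.FU t v) (A.gX t h + A.NU t w)

theorem Derivs.linearised_sub_smul (A : Derivs D Γ n k l) (t c : ℝ) (h h' : fieldSpace D Γ n)
    (v v' : L2D D k) (w w' : L2S D l) :
    A.linearised t (h - c • h') (v - c • v') (w - c • w')
      = A.linearised t h v w - c • A.linearised t h' v' w' := by
  have ha : A.aX t (h - c • h') = A.aX t h - c • A.aX t h' := map_sub_smul _ c h h'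
  have hf : A.fX t (h - c • h') + A.FU t (v - c • v')
      = A.fX t h + A.FU t v - c • (A.fX t h' + A.FU t v') :=
    map_sub_smul ((A.fX t).coprod (A.FU t)) c (h, v) (h', v')
  have hg : A.gX t (h - c • h') + A.NU t (w - c • w')
      = A.gX t h + A.NU t w - c • (A.gX t h' + A.NU t w') :=
    map_sub_smul ((A.gX t).coprod (A.NU t)) c (h, w) (h', w')
  exact (congr (congrArg₂ weakForm ha hf) hg).trans (weakForm_sub_smul _ _ _ _ _ _ _)

theorem Derivs.linearised_sub_smul_zero_zero (A : Derivs D Γ n k l) (t c : ℝ)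
    (h h' : fieldSpace D Γ n) (v : L2D D k) (w : L2S D l) :
    A.linearised t (h - c • h') 0 0
      = A.linearised t h (c • v) (c • w) - c • A.linearised t h' v w :=
  (congrArg₂ (A.linearised t (h - c • h')) (sub_self (c • v)).symm (sub_self (c • w)).symm).trans
    (A.linearised_sub_smul t c h h' _ v _ w)

theorem Derivs.linearised_zero_zero (A : Derivs D Γ n k l) (t : ℝ) (h : fieldSpace D Γ n) :
    A.linearised t h 0 0 = weakForm (A.aX t h) (A.fX t h) (A.gX t h) := by
  simp only [linearised, map_zero, add_zero]

theorem Derivs.linearised_apply (A : Derivs D Γ n k l) (t : ℝ) (h q : fieldSpace D Γ n)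
    (v : L2D D k) (w : L2S D l) :
    A.linearised t h v w q = adjointForm (A.aX t) (A.fX t) (A.gX t) q h
      + ⟪(A.FU t).adjoint (val q), v⟫_ℝ - ⟪(A.NU t).adjoint (tr q), w⟫_ℝ := by
  have hlin : A.linearised t h v w q = -∑ i, ⟪A.aX t h i, grad i q⟫_ℝ
      + ⟪A.fX t h + A.FU t v, val q⟫_ℝ - ⟪A.gX t h + A.NU t w, tr q⟫_ℝ := weakForm_apply _ _ _ _
  have hadj := (adjointForm_apply (A.aX t) (A.fX t) (A.gX t) q h).trans (weakForm_apply _ _ _ _)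
  have hFU : ⟪(A.FU t).adjoint (val q), v⟫_ℝ = ⟪A.FU t v, val q⟫_ℝ :=
    ((A.FU t).adjoint_inner_left v (val q)).trans (real_inner_comm _ _)
  have hNU : ⟪(A.NU t).adjoint (tr q), w⟫_ℝ = ⟪A.NU t w, tr q⟫_ℝ :=
    ((A.NU t).adjoint_inner_left w (tr q)).trans (real_inner_comm _ _)
  linear_combination hlin - hadj - hFU + hNU + inner_add_left (𝕜 := ℝ) (A.fX t h) (A.FU t v) (val q)
    - inner_add_left (𝕜 := ℝ) (A.gX t h) (A.NU t w) (tr q)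

end WeakForms

/-! ### First variation of the cost -/

section FirstVariation

variable {d : ℕ} {D Γ : Set (Euc d)} {n k l : ℕ} {A : Derivs D Γ n k l} {t₀ tf : ℝ}
  {VX h : Path D Γ n} {VXX : OpPath D Γ n} {v : ℝ → L2D D k} {w : ℝ → L2S D l}

/-- `h` is the response of the linearised dynamics, started at zero, to the control variations `v`
in `D` and `w` on `S`. -/
def Derivs.IsVariation (A : Derivs D Γ n k l) (t₀ tf : ℝ) (v : ℝ → L2D D k) (w : ℝ → L2S D l)
    (h : Path D Γ n) : Prop :=
  HasWeakTimeDeriv t₀ tf h (fun t => A.linearised t (h t).2 (v t) (w t)) ∧ (h t₀).1 = 0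

/-- The first variation of the cost in the direction of the state variation `h` and of the control
variations `v` in `D` and `w` on `S`. -/
noncomputable def Derivs.costVariation (A : Derivs D Γ n k l) (t₀ tf : ℝ) (h : Path D Γ n)
    (v : ℝ → L2D D k) (w : ℝ → L2S D l) : ℝ :=
  ⟪A.φX, (h tf).1⟫_ℝ
    + ∫ t in t₀..tf, (⟪A.LX t, (h t).1⟫_ℝ + ⟪A.LUd t, v t⟫_ℝ + ⟪A.LUb t, w t⟫_ℝ)

theorem Derivs.Regular.intervalIntegrable_gradient (hA : A.Regular t₀ tf) (h₀ : t₀ ≤ tf)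
    (hh : IsPath t₀ tf h) (hv : MemLp v 2 (timeMeasure t₀ tf))
    (hw : MemLp w 2 (timeMeasure t₀ tf)) :
    IntervalIntegrable (fun t => ⟪A.LX t, (h t).1⟫_ℝ + ⟪A.LUd t, v t⟫_ℝ + ⟪A.LUb t, w t⟫_ℝ)
      volume t₀ tf :=
  ((intervalIntegrable_inner h₀ hA.memLp_LX hh.memLp_fst).add
    (intervalIntegrable_inner h₀ hA.memLp_LUd hv)).add
    (intervalIntegrable_inner h₀ hA.memLp_LUb hw)

/-- The time derivative of `V_X` prescribed by the first order backward value equation. -/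
noncomputable def Derivs.valueForm (A : Derivs D Γ n k l) (VX : Path D Γ n) (VXX : OpPath D Γ n)
    (t : ℝ) : fieldSpace D Γ n →L[ℝ] ℝ :=
  -((innerSL ℝ (A.LX t)).comp val + adjointForm (A.aX t) (A.fX t) (A.gX t) (VX t).2
    - (innerSL ℝ (A.invd t (A.Qd VX t))).comp (A.QdX VXX t)
    - (innerSL ℝ (A.invb t (A.Qb VX t))).comp (A.QbX VXX t))

theorem Derivs.valueForm_apply (A : Derivs D Γ n k l) (VX : Path D Γ n) (VXX : OpPath D Γ n)
    (t : ℝ) (P : fieldSpace D Γ n) :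
    A.valueForm VX VXX t P = -(⟪A.LX t, val P⟫_ℝ
      + adjointForm (A.aX t) (A.fX t) (A.gX t) (VX t).2 P
      - ⟪A.invd t (A.Qd VX t), A.QdX VXX t P⟫_ℝ - ⟪A.invb t (A.Qb VX t), A.QbX VXX t P⟫_ℝ) :=
  rfl

/-- The adjoint terms of the value equation cancel against the linearised dynamics. -/
theorem Derivs.valueForm_add_linearised (A : Derivs D Γ n k l) (VXX : OpPath D Γ n) {t : ℝ}
    (ht : val (VX t).2 = (VX t).1) (P : fieldSpace D Γ n) (v : L2D D k) (w : L2S D l) :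
    A.valueForm VX VXX t P + A.linearised t P v w (VX t).2
        + (⟪A.LX t, val P⟫_ℝ + ⟪A.LUd t, v⟫_ℝ + ⟪A.LUb t, w⟫_ℝ)
      = ⟪A.Qd VX t, v⟫_ℝ + ⟪A.Qb VX t, w⟫_ℝ + ⟪A.invd t (A.Qd VX t), A.QdX VXX t P⟫_ℝ
        + ⟪A.invb t (A.Qb VX t), A.QbX VXX t P⟫_ℝ := by
  have hQd : ⟪A.Qd VX t, v⟫_ℝ = ⟪A.LUd t, v⟫_ℝ + ⟪(A.FU t).adjoint (val (VX t).2), v⟫_ℝ :=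
    (inner_add_left _ _ _).trans (by rw [ht])
  have hQb : ⟪A.Qb VX t, w⟫_ℝ = ⟪A.LUb t, w⟫_ℝ - ⟪(A.NU t).adjoint (tr (VX t).2), w⟫_ℝ :=
    inner_sub_left _ _ _
  linear_combination A.valueForm_apply VX VXX t P + A.linearised_apply t P (VX t).2 v w
    - hQd - hQb

theorem Derivs.IsVariation.costVariation_eq (hh : A.IsVariation t₀ tf v w h)
    (hA : A.Regular t₀ tf) (h₀ : t₀ ≤ tf) (hVX : A.BackwardFirst t₀ tf VX VXX)
    (hv : MemLp v 2 (timeMeasure t₀ tf)) (hw : MemLp w 2 (timeMeasure t₀ tf)) :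
    A.costVariation t₀ tf h v w = ∫ t in t₀..tf, (⟪A.Qd VX t, v t⟫_ℝ + ⟪A.Qb VX t, w t⟫_ℝ
      + ⟪A.invd t (A.Qd VX t), A.QdX VXX t (h t).2⟫_ℝ
      + ⟪A.invb t (A.Qb VX t), A.QbX VXX t (h t).2⟫_ℝ) := by
  have hV : HasWeakTimeDeriv t₀ tf VX (A.valueForm VX VXX) := hVX.1
  have hfinal : ⟪A.φX, (h tf).1⟫_ℝ = ⟪(VX tf).1, (h tf).1⟫_ℝ :=
    congrArg (inner ℝ · (h tf).1) hVX.2.symm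
  refine (congrArg (· + _) hfinal).trans <| hV.inner_add_integral_eq h₀ hh.1 hh.2
    (hA.intervalIntegrable_gradient h₀ hh.1.isPath hv hw) ?_
  filter_upwards [hV.isPath.val_eq, hh.1.isPath.val_eq] with t hVt hht
  rw [← hht]
  exact A.valueForm_add_linearised VXX hVt _ _ _

end FirstVariation

section Update

variable {d : ℕ} {D Γ : Set (Euc d)} {n k l : ℕ} {A : Derivs D Γ n k l} {t₀ tf : ℝ}
  {VX δX : Path D Γ n} {VXX : OpPath D Γ n}

theorem Derivs.Regular.inner_Qd_δUd (hA : A.Regular t₀ tf) {t : ℝ} (ht : t ∈ Icc t₀ tf) :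
    ⟪A.Qd VX t, A.δUd VX VXX δX t⟫_ℝ = -⟪A.Qd VX t, A.invd t (A.Qd VX t)⟫_ℝ
      - ⟪A.invd t (A.Qd VX t), A.QdX VXX t (δX t).2⟫_ℝ := by
  rw [δUd, inner_sub_right, inner_neg_right, hA.invd_symm ht]

theorem Derivs.Regular.inner_Qb_δUb (hA : A.Regular t₀ tf) {t : ℝ} (ht : t ∈ Icc t₀ tf) :
    ⟪A.Qb VX t, A.δUb VX VXX δX t⟫_ℝ = -⟪A.Qb VX t, A.invb t (A.Qb VX t)⟫_ℝ
      - ⟪A.invb t (A.Qb VX t), A.QbX VXX t (δX t).2⟫_ℝ := by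
  rw [δUb, inner_sub_right, inner_neg_right, hA.invb_symm ht]

/-- The feedback part of the update absorbs the feedback terms of the value equation. -/
theorem Derivs.Variation.costVariation_eq (hδX : A.Variation t₀ tf VX VXX δX)
    (hA : A.Regular t₀ tf) (h₀ : t₀ ≤ tf) (hVX : A.BackwardFirst t₀ tf VX VXX)
    (hd : MemLp (A.δUd VX VXX δX) 2 (timeMeasure t₀ tf))
    (hb : MemLp (A.δUb VX VXX δX) 2 (timeMeasure t₀ tf)) :
    A.costVariation t₀ tf δX (A.δUd VX VXX δX) (A.δUb VX VXX δX) = -∫ t in t₀..tf,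
      (⟪A.Qd VX t, A.invd t (A.Qd VX t)⟫_ℝ + ⟪A.Qb VX t, A.invb t (A.Qb VX t)⟫_ℝ) := by
  have hvar : A.IsVariation t₀ tf (A.δUd VX VXX δX) (A.δUb VX VXX δX) δX := hδX
  rw [hvar.costVariation_eq hA h₀ hVX hd hb, ← intervalIntegral.integral_neg]
  refine intervalIntegral.integral_congr fun t ht => ?_
  rw [uIcc_of_le h₀] at ht
  linear_combination hA.inner_Qd_δUd ht + hA.inner_Qb_δUb ht

end Update

/-! ### Second order remainders -/

section Linearisation

theorem isBigO_of_le_add_of_isBigO_sq {α : Type*} {l : Filter α} {p q u w : α → ℝ}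
    (hp : Tendsto p l (𝓝 0)) (hq : Tendsto q l (𝓝 0)) (hle : ∀ᶠ x in l, ‖p x‖ ≤ ‖u x‖ + ‖w x‖)
    (hu : u =O[l] q) (hw : w =O[l] fun x => (‖p x‖ + ‖q x‖) ^ 2) : p =O[l] q := by
  have hlim : Tendsto (fun x => ‖p x‖ + ‖q x‖) l (𝓝 0) := by simpa using hp.norm.add hq.norm
  have hsq : (fun x => (‖p x‖ + ‖q x‖) ^ 2) =o[l] fun x => ‖p x‖ + ‖q x‖ := by
    simpa only [sq, mul_one] using (Asymptotics.isBigO_refl _ l).mul_isLittleO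
      ((Asymptotics.isLittleO_one_iff ℝ).2 hlim)
  obtain ⟨K, hK⟩ := hu.bound
  refine Asymptotics.IsBigO.of_bound (2 * K + 1) ?_
  filter_upwards [hle, hK, (hw.trans_isLittleO hsq).bound one_half_pos] with x hx hux hwx
  rw [Real.norm_of_nonneg (by positivity : 0 ≤ ‖p x‖ + ‖q x‖)] at hwx
  linarith

variable {d : ℕ} {D Γ : Set (Euc d)} {n k l : ℕ} {A : Derivs D Γ n k l} {sys : System D Γ n k l}
  {t₀ tf : ℝ} {X₀ : L2D D n} {x δX : Path D Γ n} {ud vd : ℝ → L2D D k} {ub vb : ℝ → L2S D l}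

theorem eventually_eLpNorm_add_smul_sub_lt {E α : Type*} [NormedAddCommGroup E] [NormedSpace ℝ E]
    [MeasurableSpace α] {μ : Measure α} {p : ℝ≥0∞} {v : α → E} (u : α → E) (hv : MemLp v p μ)
    {δ : ℝ} (hδ : 0 < δ) :
    ∀ᶠ γ in 𝓝 (0 : ℝ), eLpNorm (u + γ • v - u) p μ < ENNReal.ofReal δ := by
  have hlim : Tendsto (fun γ : ℝ => ‖γ‖ₑ * eLpNorm v p μ) (𝓝 0) (𝓝 0) := by
    simpa using ENNReal.Tendsto.mul_const (b := eLpNorm v p μ)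
      (continuous_enorm.tendsto (0 : ℝ)) (Or.inr hv.2.ne)
  filter_upwards [hlim.eventually (gt_mem_nhds (ENNReal.ofReal_pos.2 hδ))] with γ hγ
  rwa [add_sub_cancel_left, eLpNorm_const_smul]

theorem System.WellPosed.tendsto_pathNorm_sub (hwp : sys.WellPosed t₀ tf)
    (hud : MemLp ud 2 (timeMeasure t₀ tf)) (hub : MemLp ub 2 (timeMeasure t₀ tf))
    (hvd : MemLp vd 2 (timeMeasure t₀ tf)) (hvb : MemLp vb 2 (timeMeasure t₀ tf))
    (hx : sys.IsSolution t₀ tf X₀ ud ub x) {y : ℝ → Path D Γ n}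
    (hy : ∀ γ : ℝ, sys.IsSolution t₀ tf X₀ (ud + γ • vd) (ub + γ • vb) (y γ)) :
    Tendsto (fun γ => pathNorm t₀ tf (y γ - x)) (𝓝 0) (𝓝 0) := by
  refine (nhds_basis_abs_sub_lt (0 : ℝ)).tendsto_right_iff.2 fun ε hε => ?_
  obtain ⟨δ, hδ, hclose⟩ := hwp.stability X₀ ud ub x hud hub hx ε hε
  filter_upwards [eventually_eLpNorm_add_smul_sub_lt ud hvd hδ,
    eventually_eLpNorm_add_smul_sub_lt ub hvb hδ] with γ hd hb
  rw [sub_zero, abs_of_nonneg (pathNorm_nonneg _)]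
  exact hclose X₀ _ _ _ (hud.add (hvd.const_smul γ)) (hub.add (hvb.const_smul γ)) (hy γ)
    (by simpa using hδ) hd hb

/-- The remainder of the first order expansion at time `t` of the dynamics around the state `X`
and the controls `u`, `b`, for the state variation `h` and the control variations `v`, `w`. -/
noncomputable def Derivs.systemRemainder (A : Derivs D Γ n k l) (sys : System D Γ n k l) (t : ℝ)
    (X : fieldSpace D Γ n) (u : L2D D k) (b : L2S D l) (h : fieldSpace D Γ n) (v : L2D D k)
    (w : L2S D l) : fieldSpace D Γ n →L[ℝ] ℝ :=
  sys.rhs t (X + h) (u + v) (b + w) - sys.rhs t X u b - A.linearised t h v w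

theorem Derivs.linearised_sub_smul_add_systemRemainder (A : Derivs D Γ n k l)
    (sys : System D Γ n k l) (t c : ℝ) {X Y h : fieldSpace D Γ n} (hY : X + h = Y)
    (δ : fieldSpace D Γ n) (u v : L2D D k) (b w : L2S D l) :
    A.linearised t (h - c • δ) 0 0 + A.systemRemainder sys t X u b h (c • v) (c • w)
      = sys.rhs t Y (u + c • v) (b + c • w) - sys.rhs t X u b - c • A.linearised t δ v w := by
  subst hY
  exact (congrArg (· + A.systemRemainder sys t X u b h (c • v) (c • w))
    (A.linearised_sub_smul_zero_zero t c h δ v w)).trans (sub_add_sub_cancel' _ _ _)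

theorem HasWeakTimeDeriv.congr {ℓ ℓ' : ℝ → fieldSpace D Γ n →L[ℝ] ℝ}
    (hx : HasWeakTimeDeriv t₀ tf x ℓ) (hℓ : ∀ t, ℓ' t = ℓ t) : HasWeakTimeDeriv t₀ tf x ℓ' :=
  funext hℓ ▸ hx

theorem Derivs.IsVariation.hasWeakTimeDeriv_sub_sub_smul (hδX : A.IsVariation t₀ tf vd vb δX)
    (hx : sys.IsSolution t₀ tf X₀ ud ub x) {γ : ℝ} {y : Path D Γ n}
    (hy : sys.IsSolution t₀ tf X₀ (ud + γ • vd) (ub + γ • vb) y) :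
    HasWeakTimeDeriv t₀ tf (y - x - γ • δX) (fun t =>
      A.linearised t ((y - x - γ • δX) t).2 0 0
        + A.systemRemainder sys t (x t).2 (ud t) (ub t) ((y - x) t).2 (γ • vd t) (γ • vb t)) :=
  ((hy.1.sub hx.1).sub (hδX.1.const_smul γ)).congr fun t =>
    A.linearised_sub_smul_add_systemRemainder sys t γ
      (congrArg Prod.snd (add_sub_cancel (x t) (y t))) (δX t).2 (ud t) (vd t) (ub t) (vb t)

theorem Derivs.VariationWellPosed.exists_pathNorm_le (hL : A.VariationWellPosed t₀ tf) :
    ∃ K : ℝ, ∀ (ℓ : ℝ → fieldSpace D Γ n →L[ℝ] ℝ) (z : Path D Γ n),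
      HasWeakTimeDeriv t₀ tf z (fun t => A.linearised t (z t).2 0 0 + ℓ t) →
      MemLp ℓ 2 (timeMeasure t₀ tf) →
      pathNorm t₀ tf z ≤ K * (‖(z t₀).1‖ + (eLpNorm ℓ 2 (timeMeasure t₀ tf)).toReal) :=
  hL.stability.imp fun _ hK ℓ z hz hℓ => hK ℓ z hℓ <| hz.congr fun t =>
    congrArg (· + ℓ t) (A.linearised_zero_zero t (z t).2).symm

theorem Derivs.VariationWellPosed.exists_pathNorm_le_of_eLpNorm_le
    (hL : A.VariationWellPosed t₀ tf) :
    ∃ K : ℝ, ∀ (ℓ : ℝ → fieldSpace D Γ n →L[ℝ] ℝ) (z : Path D Γ n) (c : ℝ),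
      HasWeakTimeDeriv t₀ tf z (fun t => A.linearised t (z t).2 0 0 + ℓ t) → (z t₀).1 = 0 →
      MemLp ℓ 2 (timeMeasure t₀ tf) → eLpNorm ℓ 2 (timeMeasure t₀ tf) ≤ ENNReal.ofReal c →
      pathNorm t₀ tf z ≤ ‖K‖ * ‖c‖ :=
  hL.exists_pathNorm_le.imp fun K hK ℓ z c hz hz₀ hℓ hℓc => by
    have hinit : ‖(z t₀).1‖ = 0 := norm_eq_zero.2 hz₀
    have hc : (eLpNorm ℓ 2 (timeMeasure t₀ tf)).toReal ≤ ‖c‖ :=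
      ENNReal.toReal_le_of_le_ofReal (norm_nonneg c)
        (hℓc.trans (ENNReal.ofReal_le_ofReal (Real.le_norm_self c)))
    have hsum := (add_le_add hinit.le hc).trans_eq (zero_add _)
    exact (hK ℓ z hz hℓ).trans (mul_le_mul (Real.le_norm_self K) hsum
      (add_nonneg (norm_nonneg _) ENNReal.toReal_nonneg) (norm_nonneg K))

theorem Derivs.IsVariation.sub_sub_smul_eq_zero (hδX : A.IsVariation t₀ tf vd vb δX)
    (hx : sys.IsSolution t₀ tf X₀ ud ub x) {γ : ℝ} {y : Path D Γ n}
    (hy : sys.IsSolution t₀ tf X₀ (ud + γ • vd) (ub + γ • vb) y) :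
    ((y - x - γ • δX) t₀).1 = 0 := by
  have hyx : (y t₀).1 - (x t₀).1 = 0 := sub_eq_zero.2 (hy.2.trans hx.2.symm)
  have hδ : γ • (δX t₀).1 = 0 := (congrArg (γ • ·) hδX.2).trans (smul_zero γ)
  exact (congrArg₂ (· - ·) hyx hδ).trans (sub_zero 0)

theorem Derivs.IsVariation.exists_pathNorm_sub_sub_smul_le (hδX : A.IsVariation t₀ tf vd vb δX)
    (hL : A.VariationWellPosed t₀ tf) (hS : A.SystemExpansion sys t₀ tf x ud vd ub vb)
    (hx : sys.IsSolution t₀ tf X₀ ud ub x) :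
    ∃ K : ℝ, ∃ r > 0, ∀ (γ : ℝ) (y : Path D Γ n),
      sys.IsSolution t₀ tf X₀ (ud + γ • vd) (ub + γ • vb) y → |γ| ≤ r →
      pathNorm t₀ tf (y - x) ≤ r →
      pathNorm t₀ tf (y - x - γ • δX) ≤ K * (pathNorm t₀ tf (y - x) + |γ|) ^ 2 := by
  obtain ⟨K, hK⟩ := hL.exists_pathNorm_le_of_eLpNorm_le
  obtain ⟨K', r, hr, hR⟩ := hS
  refine ⟨‖K‖ * ‖K'‖, r, hr, fun γ y hy hγ hp => ?_⟩
  obtain ⟨hmem, hle⟩ := hR γ (y - x) hγ (hy.1.isPath.sub hx.1.isPath) hp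
  have hbound := hK _ _ _ (hδX.hasWeakTimeDeriv_sub_sub_smul hx hy)
    (hδX.sub_sub_smul_eq_zero hx hy) hmem hle
  rwa [norm_mul, Real.norm_of_nonneg (sq_nonneg _), ← mul_assoc] at hbound

theorem Derivs.IsVariation.pathNorm_sub_le (hδX : A.IsVariation t₀ tf vd vb δX) (h₀ : t₀ ≤ tf)
    (hx : sys.IsSolution t₀ tf X₀ ud ub x) {γ : ℝ} {y : Path D Γ n}
    (hy : sys.IsSolution t₀ tf X₀ (ud + γ • vd) (ub + γ • vb) y) :
    pathNorm t₀ tf (y - x) ≤ pathNorm t₀ tf δX * |γ| + pathNorm t₀ tf (y - x - γ • δX) := by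
  have hz := (hy.1.isPath.sub hx.1.isPath).sub (hδX.1.isPath.const_smul γ)
  have hadd := (hδX.1.isPath.const_smul γ).pathNorm_add_le h₀ hz
  rwa [add_sub_cancel, pathNorm_smul, mul_comm] at hadd

theorem Derivs.IsVariation.pathNorm_sub_sub_smul_isBigO (hδX : A.IsVariation t₀ tf vd vb δX)
    (hL : A.VariationWellPosed t₀ tf) (hS : A.SystemExpansion sys t₀ tf x ud vd ub vb)
    (hx : sys.IsSolution t₀ tf X₀ ud ub x) {y : ℝ → Path D Γ n}
    (hy : ∀ γ : ℝ, sys.IsSolution t₀ tf X₀ (ud + γ • vd) (ub + γ • vb) (y γ))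
    (hlim : Tendsto (fun γ => pathNorm t₀ tf (y γ - x)) (𝓝 0) (𝓝 0)) :
    (fun γ => pathNorm t₀ tf (y γ - x - γ • δX))
      =O[𝓝 0] fun γ => (‖pathNorm t₀ tf (y γ - x)‖ + ‖γ‖) ^ 2 := by
  obtain ⟨K, r, hr, hK⟩ := hδX.exists_pathNorm_sub_sub_smul_le hL hS hx
  refine Asymptotics.IsBigO.of_bound K ?_
  filter_upwards [hlim.eventually_le_const hr,
    (continuous_abs.tendsto' (0 : ℝ) 0 abs_zero).eventually_le_const hr] with γ hp hγ
  rw [Real.norm_of_nonneg (pathNorm_nonneg _), Real.norm_of_nonneg (pathNorm_nonneg _),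
    Real.norm_of_nonneg (sq_nonneg _)]
  exact hK γ (y γ) (hy γ) hγ hp

theorem Derivs.IsVariation.linearisation_isBigO (hδX : A.IsVariation t₀ tf vd vb δX)
    (h₀ : t₀ ≤ tf) (hL : A.VariationWellPosed t₀ tf)
    (hS : A.SystemExpansion sys t₀ tf x ud vd ub vb)
    (hx : sys.IsSolution t₀ tf X₀ ud ub x) {y : ℝ → Path D Γ n}
    (hy : ∀ γ : ℝ, sys.IsSolution t₀ tf X₀ (ud + γ • vd) (ub + γ • vb) (y γ))
    (hlim : Tendsto (fun γ => pathNorm t₀ tf (y γ - x)) (𝓝 0) (𝓝 0)) :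
    (fun γ => pathNorm t₀ tf (y γ - x)) =O[𝓝 0] (fun γ => γ) ∧
      (fun γ => pathNorm t₀ tf (y γ - x - γ • δX)) =O[𝓝 0] fun γ => γ ^ 2 := by
  have hquad := hδX.pathNorm_sub_sub_smul_isBigO hL hS hx hy hlim
  have hlin : (fun γ => pathNorm t₀ tf (y γ - x)) =O[𝓝 0] fun γ => γ := by
    refine isBigO_of_le_add_of_isBigO_sq hlim tendsto_id (Eventually.of_forall fun γ => ?_)
      ((Asymptotics.isBigO_refl _ _).abs_left.const_mul_left (pathNorm t₀ tf δX)) hquad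
    rw [Real.norm_of_nonneg (pathNorm_nonneg _), Real.norm_of_nonneg (pathNorm_nonneg _)]
    exact (hδX.pathNorm_sub_le h₀ hx (hy γ)).trans (add_le_add_left (Real.le_norm_self _) _)
  exact ⟨hlin, hquad.trans ((hlin.norm_left.add (Asymptotics.isBigO_refl _ _).norm_left).pow 2)⟩

end Linearisation

section CostExpansion

variable {E F H : Type*} [NormedAddCommGroup E] [InnerProductSpace ℝ E] [NormedAddCommGroup F]
  [InnerProductSpace ℝ F] [NormedAddCommGroup H] [InnerProductSpace ℝ H]

theorem isBigO_sq_of_taylor_of_isBigO_sq {φ : H → ℝ} {a g δ : H} {h : ℝ → H}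
    (hφ : ∃ K : ℝ, ∃ r > 0, ∀ z, ‖z‖ ≤ r → |φ (a + z) - φ a - ⟪g, z⟫_ℝ| ≤ K * ‖z‖ ^ 2)
    (hh : h =O[𝓝 0] fun γ : ℝ => γ) (hδ : (fun γ => h γ - γ • δ) =O[𝓝 0] fun γ : ℝ => γ ^ 2) :
    (fun γ => φ (a + h γ) - φ a - γ * ⟪g, δ⟫_ℝ) =O[𝓝 0] fun γ => γ ^ 2 := by
  obtain ⟨K, r, hr, hK⟩ := hφ
  have hlim : Tendsto (fun γ => ‖h γ‖) (𝓝 0) (𝓝 0) := by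
    simpa using (hh.trans_tendsto tendsto_id).norm
  have htaylor : (fun γ => φ (a + h γ) - φ a - ⟪g, h γ⟫_ℝ) =O[𝓝 0] fun γ => γ ^ 2 := by
    refine Asymptotics.IsBigO.trans (.of_bound K ?_) (hh.norm_left.pow 2)
    filter_upwards [hlim.eventually_le_const hr] with γ hγ
    rw [Real.norm_of_nonneg (sq_nonneg _)]
    exact hK _ hγ
  refine (htaylor.add (((innerSL ℝ g).isBigO_comp _ _).trans hδ)).congr_left fun γ => ?_
  rw [innerSL_apply_apply, inner_sub_right, real_inner_smul_right]
  ring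

theorem inner_add_inner_smul_add_inner_smul (a h δ : H) (b v : E) (c w : F) (γ : ℝ) :
    ⟪a, h⟫_ℝ + ⟪b, γ • v⟫_ℝ + ⟪c, γ • w⟫_ℝ
      = γ * (⟪a, δ⟫_ℝ + ⟪b, v⟫_ℝ + ⟪c, w⟫_ℝ) + ⟪a, h - γ • δ⟫_ℝ := by
  simp only [inner_sub_right, real_inner_smul_right]
  ring

variable {d : ℕ} {D Γ : Set (Euc d)} {n k l : ℕ} {A : Derivs D Γ n k l} {C : Cost D n k l}
  {t₀ tf : ℝ} {x h δX : Path D Γ n} {ud vd : ℝ → L2D D k} {ub vb : ℝ → L2S D l}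

theorem IsPath.abs_integral_inner_le (hh : IsPath t₀ tf h) (h₀ : t₀ ≤ tf) {g : ℝ → L2D D n}
    (hg : MemLp g 2 (timeMeasure t₀ tf)) :
    |∫ t in t₀..tf, ⟪g t, (h t).1⟫_ℝ| ≤ (∫ t in t₀..tf, ‖g t‖) * pathNorm t₀ tf h := by
  have hgi : IntervalIntegrable (fun t => ‖g t‖) volume t₀ tf :=
    (intervalIntegrable_iff_integrable_timeMeasure h₀).2 (hg.integrable one_le_two).norm
  rw [← intervalIntegral.integral_mul_const]
  refine (intervalIntegral.abs_integral_le_integral_abs h₀).trans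
    (intervalIntegral.integral_mono_on h₀ (intervalIntegrable_inner h₀ hg hh.memLp_fst).abs
      (hgi.mul_const _) fun t ht => ?_)
  exact (abs_real_inner_le_norm _ _).trans
    (mul_le_mul_of_nonneg_left (hh.norm_le_pathNorm ht) (norm_nonneg _))

theorem Derivs.Regular.integral_gradient_smul (hA : A.Regular t₀ tf) (h₀ : t₀ ≤ tf)
    (hh : IsPath t₀ tf h) (hδX : IsPath t₀ tf δX) (hvd : MemLp vd 2 (timeMeasure t₀ tf))
    (hvb : MemLp vb 2 (timeMeasure t₀ tf)) (γ : ℝ) :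
    ∫ t in t₀..tf, (⟪A.LX t, (h t).1⟫_ℝ + ⟪A.LUd t, γ • vd t⟫_ℝ + ⟪A.LUb t, γ • vb t⟫_ℝ)
      = γ * (∫ t in t₀..tf, (⟪A.LX t, (δX t).1⟫_ℝ + ⟪A.LUd t, vd t⟫_ℝ + ⟪A.LUb t, vb t⟫_ℝ))
        + ∫ t in t₀..tf, ⟪A.LX t, ((h - γ • δX) t).1⟫_ℝ := by
  rw [← intervalIntegral.integral_const_mul, ← intervalIntegral.integral_add
    ((hA.intervalIntegrable_gradient h₀ hδX hvd hvb).const_mul γ)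
    (intervalIntegrable_inner h₀ hA.memLp_LX (hh.sub (hδX.const_smul γ)).memLp_fst)]
  exact intervalIntegral.integral_congr fun t _ =>
    inner_add_inner_smul_add_inner_smul _ _ _ _ _ _ _ _

theorem Derivs.CostExpansion.exists_running_remainder_le
    (hC : A.CostExpansion C t₀ tf x ud vd ub vb) (h₀ : t₀ ≤ tf) (hx : IsPath t₀ tf x) :
    ∃ K : ℝ, ∃ r > 0, ∀ (γ : ℝ) (y : Path D Γ n), |γ| ≤ r → IsPath t₀ tf y →
      pathNorm t₀ tf (y - x) ≤ r →
      IntervalIntegrable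
        (fun t => C.running t (y t).1 (ud t + γ • vd t) (ub t + γ • vb t)) volume t₀ tf ∧
      |∫ t in t₀..tf, (C.running t (y t).1 (ud t + γ • vd t) (ub t + γ • vb t)
          - C.running t (x t).1 (ud t) (ub t)
          - (⟪A.LX t, ((y - x) t).1⟫_ℝ + ⟪A.LUd t, γ • vd t⟫_ℝ + ⟪A.LUb t, γ • vb t⟫_ℝ))|
        ≤ K * (pathNorm t₀ tf (y - x) + |γ|) ^ 2 := by
  obtain ⟨K, r, hr, hK⟩ := hC.1
  refine ⟨K, r, hr, fun γ y hγ hy hp => ?_⟩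
  have hval : (fun t => C.running t ((x t).1 + ((y - x) t).1)) = fun t => C.running t (y t).1 :=
    funext fun t => congrArg (C.running t) (congrArg Prod.fst (add_sub_cancel (x t) (y t)))
  have h := hK γ (y - x) hγ (hy.sub hx) hp
  simp only [fun t => congrFun hval t] at h
  exact ⟨(intervalIntegrable_iff_integrable_timeMeasure h₀).2 h.1, h.2⟩

theorem Derivs.CostExpansion.exists_abs_running_sub_le
    (hC : A.CostExpansion C t₀ tf x ud vd ub vb) (hA : A.Regular t₀ tf) (h₀ : t₀ ≤ tf)
    (hx : IsPath t₀ tf x) (hδX : IsPath t₀ tf δX) (hvd : MemLp vd 2 (timeMeasure t₀ tf))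
    (hvb : MemLp vb 2 (timeMeasure t₀ tf)) :
    ∃ K : ℝ, ∃ r > 0, ∀ (γ : ℝ) (y : Path D Γ n), |γ| ≤ r → IsPath t₀ tf y →
      pathNorm t₀ tf (y - x) ≤ r →
      |(∫ t in t₀..tf, C.running t (y t).1 (ud t + γ • vd t) (ub t + γ • vb t))
          - (∫ t in t₀..tf, C.running t (x t).1 (ud t) (ub t))
          - γ * ∫ t in t₀..tf, (⟪A.LX t, (δX t).1⟫_ℝ + ⟪A.LUd t, vd t⟫_ℝ + ⟪A.LUb t, vb t⟫_ℝ)|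
        ≤ K * (pathNorm t₀ tf (y - x) + |γ|) ^ 2
          + (∫ t in t₀..tf, ‖A.LX t‖) * pathNorm t₀ tf (y - x - γ • δX) := by
  obtain ⟨K, r, hr, hK⟩ := hC.exists_running_remainder_le h₀ hx
  have hbase : IntervalIntegrable (fun t => C.running t (x t).1 (ud t) (ub t)) volume t₀ tf := by
    simpa using (hK 0 x (by simpa using hr.le) hx (by simpa [pathNorm_zero] using hr.le)).1
  refine ⟨K, r, hr, fun γ y hγ hy hp => ?_⟩
  obtain ⟨hyi, hrem⟩ := hK γ y hγ hy hp
  have hh := hy.sub hx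
  have hgrad : IntervalIntegrable (fun t => ⟪A.LX t, ((y - x) t).1⟫_ℝ + ⟪A.LUd t, γ • vd t⟫_ℝ
      + ⟪A.LUb t, γ • vb t⟫_ℝ) volume t₀ tf :=
    hA.intervalIntegrable_gradient h₀ hh (hvd.const_smul γ) (hvb.const_smul γ)
  rw [intervalIntegral.integral_sub (hyi.sub hbase) hgrad, intervalIntegral.integral_sub hyi hbase,
    hA.integral_gradient_smul h₀ hh hδX hvd hvb, ← sub_sub] at hrem
  have hlin := (hh.sub (hδX.const_smul γ)).abs_integral_inner_le h₀ hA.memLp_LX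
  rw [← sub_le_iff_le_add]
  exact (sub_le_sub_left hlin _).trans ((abs_sub_abs_le_abs_sub _ _).trans hrem)

theorem Derivs.CostExpansion.running_sub_isBigO (hC : A.CostExpansion C t₀ tf x ud vd ub vb)
    (hA : A.Regular t₀ tf) (h₀ : t₀ ≤ tf) (hx : IsPath t₀ tf x) (hδX : IsPath t₀ tf δX)
    (hvd : MemLp vd 2 (timeMeasure t₀ tf)) (hvb : MemLp vb 2 (timeMeasure t₀ tf))
    {y : ℝ → Path D Γ n} (hy : ∀ γ, IsPath t₀ tf (y γ))
    (hlin : (fun γ => pathNorm t₀ tf (y γ - x)) =O[𝓝 0] fun γ => γ)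
    (hquad : (fun γ => pathNorm t₀ tf (y γ - x - γ • δX)) =O[𝓝 0] fun γ => γ ^ 2) :
    (fun γ => (∫ t in t₀..tf, C.running t (y γ t).1 (ud t + γ • vd t) (ub t + γ • vb t))
        - (∫ t in t₀..tf, C.running t (x t).1 (ud t) (ub t))
        - γ * ∫ t in t₀..tf, (⟪A.LX t, (δX t).1⟫_ℝ + ⟪A.LUd t, vd t⟫_ℝ + ⟪A.LUb t, vb t⟫_ℝ))
      =O[𝓝 0] fun γ => γ ^ 2 := by
  obtain ⟨K, r, hr, hK⟩ := hC.exists_abs_running_sub_le hA h₀ hx hδX hvd hvb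
  refine Asymptotics.IsBigO.trans (.of_bound' ?_)
    ((((hlin.add (Asymptotics.isBigO_refl _ _).abs_left).pow 2).const_mul_left K).add
      (hquad.const_mul_left (∫ t in t₀..tf, ‖A.LX t‖)))
  filter_upwards [(hlin.trans_tendsto tendsto_id).eventually_le_const hr,
    (continuous_abs.tendsto' (0 : ℝ) 0 abs_zero).eventually_le_const hr] with γ hp hγ
  exact (hK γ (y γ) hγ (hy γ) hp).trans (Real.le_norm_self _)

theorem Derivs.CostExpansion.terminal_sub_isBigO (hC : A.CostExpansion C t₀ tf x ud vd ub vb)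
    (h₀ : t₀ ≤ tf) (hx : IsPath t₀ tf x) (hδX : IsPath t₀ tf δX)
    {y : ℝ → Path D Γ n} (hy : ∀ γ, IsPath t₀ tf (y γ))
    (hlin : (fun γ => pathNorm t₀ tf (y γ - x)) =O[𝓝 0] fun γ => γ)
    (hquad : (fun γ => pathNorm t₀ tf (y γ - x - γ • δX)) =O[𝓝 0] fun γ => γ ^ 2) :
    (fun γ => C.terminal tf (y γ tf).1 - C.terminal tf (x tf).1 - γ * ⟪A.φX, (δX tf).1⟫_ℝ)
      =O[𝓝 0] fun γ => γ ^ 2 := by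
  have hyx : ∀ γ, (x tf).1 + ((y γ - x) tf).1 = (y γ tf).1 := fun γ =>
    congrArg Prod.fst (add_sub_cancel (x tf) (y γ tf))
  have hz : ∀ γ, IsPath t₀ tf (y γ - x) := fun γ => (hy γ).sub hx
  have hzlin : (fun γ => ((y γ - x) tf).1) =O[𝓝 0] fun γ => γ :=
    .trans (.of_norm_le fun γ => (hz γ).norm_le_pathNorm (right_mem_Icc.2 h₀)) hlin
  have hzquad : (fun γ => ((y γ - x - γ • δX) tf).1) =O[𝓝 0] fun γ => γ ^ 2 :=
    .trans (.of_norm_le fun γ => ((hz γ).sub (hδX.const_smul γ)).norm_le_pathNorm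
      (right_mem_Icc.2 h₀)) hquad
  exact (isBigO_sq_of_taylor_of_isBigO_sq hC.2 hzlin hzquad).congr_left fun γ =>
    congrArg (fun z => C.terminal tf z - _ - _) (hyx γ)

theorem Derivs.CostExpansion.total_sub_isBigO (hC : A.CostExpansion C t₀ tf x ud vd ub vb)
    (hA : A.Regular t₀ tf) (h₀ : t₀ ≤ tf) (hx : IsPath t₀ tf x) (hδX : IsPath t₀ tf δX)
    (hvd : MemLp vd 2 (timeMeasure t₀ tf)) (hvb : MemLp vb 2 (timeMeasure t₀ tf))
    {y : ℝ → Path D Γ n} (hy : ∀ γ, IsPath t₀ tf (y γ))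
    (hlin : (fun γ => pathNorm t₀ tf (y γ - x)) =O[𝓝 0] fun γ => γ)
    (hquad : (fun γ => pathNorm t₀ tf (y γ - x - γ • δX)) =O[𝓝 0] fun γ => γ ^ 2) :
    (fun γ => C.total t₀ tf (y γ) (ud + γ • vd) (ub + γ • vb) - C.total t₀ tf x ud ub
      - γ * A.costVariation t₀ tf δX vd vb) =O[𝓝 0] fun γ => γ ^ 2 := by
  refine ((hC.terminal_sub_isBigO h₀ hx hδX hy hlin hquad).add
    (hC.running_sub_isBigO hA h₀ hx hδX hvd hvb hy hlin hquad)).congr_left fun γ => ?_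
  simp only [Cost.total, Derivs.costVariation, Pi.add_apply, Pi.smul_apply]
  ring

end CostExpansion

section Descent

theorem hasDerivAt_of_isBigO_sq {J : ℝ → ℝ} {q : ℝ}
    (h : (fun γ => J γ - J 0 + γ * q) =O[𝓝 0] fun γ => γ ^ 2) : HasDerivAt J (-q) 0 := by
  have hsq : (fun γ : ℝ => γ ^ 2) =o[𝓝 0] fun γ => γ := by
    simpa using Asymptotics.isLittleO_pow_pow (𝕜 := ℝ) one_lt_two
  rw [hasDerivAt_iff_isLittleO]
  exact (h.trans_isLittleO hsq).congr (fun γ => by simp) fun γ => (sub_zero γ).symm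

theorem eventually_lt_of_isBigO_sq {J : ℝ → ℝ} {q : ℝ} (hq : 0 < q)
    (h : (fun γ => J γ - J 0 + γ * q) =O[𝓝 0] fun γ => γ ^ 2) :
    ∀ᶠ γ in 𝓝[>] (0 : ℝ), J γ < J 0 := by
  have hslope := (hasDerivAt_of_isBigO_sq h).hasDerivWithinAt (s := Ioi 0)
  rw [hasDerivWithinAt_iff_tendsto_slope' self_notMem_Ioi] at hslope
  filter_upwards [hslope.eventually (gt_mem_nhds (neg_neg_of_pos hq)), self_mem_nhdsWithin]
    with γ hneg hγ
  rw [slope_def_field, sub_zero] at hneg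
  exact sub_neg.1 (neg_of_div_neg_left hneg (le_of_lt hγ))

theorem hasDerivAt_comp_mul_const_of_isBigO_sq {J : ℝ → ℝ} {q : ℝ}
    (h : (fun γ => J γ - J 0 + γ * q) =O[𝓝 0] fun γ => γ ^ 2) (γ : ℝ) :
    HasDerivAt (fun i => J (i * γ)) (-γ * q) 0 := by
  have hJ : HasDerivAt J (-q) (0 * γ) := by
    simpa only [zero_mul] using hasDerivAt_of_isBigO_sq h
  convert! hJ.comp (0 : ℝ) ((hasDerivAt_id (0 : ℝ)).mul_const γ) using 1
  ring

variable {d : ℕ} {D Γ : Set (Euc d)} {n k l : ℕ} {A : Derivs D Γ n k l} {sys : System D Γ n k l}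
  {C : Cost D n k l} {t₀ tf : ℝ} {X₀ : L2D D n} {x VX δX : Path D Γ n} {VXX : OpPath D Γ n}
  {ud : ℝ → L2D D k} {ub : ℝ → L2S D l}

theorem System.WellPosed.total_update_isBigO (hwp : sys.WellPosed t₀ tf) (h₀ : t₀ ≤ tf)
    (hA : A.Regular t₀ tf) (hL : A.VariationWellPosed t₀ tf)
    (hud : MemLp ud 2 (timeMeasure t₀ tf)) (hub : MemLp ub 2 (timeMeasure t₀ tf))
    (hx : sys.IsSolution t₀ tf X₀ ud ub x)
    (hVX : A.BackwardFirst t₀ tf VX VXX) (hδX : A.Variation t₀ tf VX VXX δX)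
    (hd : MemLp (A.δUd VX VXX δX) 2 (timeMeasure t₀ tf))
    (hb : MemLp (A.δUb VX VXX δX) 2 (timeMeasure t₀ tf))
    (hS : A.SystemExpansion sys t₀ tf x ud (A.δUd VX VXX δX) ub (A.δUb VX VXX δX))
    (hC : A.CostExpansion C t₀ tf x ud (A.δUd VX VXX δX) ub (A.δUb VX VXX δX))
    {y : ℝ → Path D Γ n} (hy : ∀ γ : ℝ, sys.IsSolution t₀ tf X₀ (ud + γ • A.δUd VX VXX δX)
      (ub + γ • A.δUb VX VXX δX) (y γ)) :
    (fun γ => C.total t₀ tf (y γ) (ud + γ • A.δUd VX VXX δX) (ub + γ • A.δUb VX VXX δX)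
      - C.total t₀ tf x ud ub + γ * ∫ t in t₀..tf, (⟪A.Qd VX t, A.invd t (A.Qd VX t)⟫_ℝ
        + ⟪A.Qb VX t, A.invb t (A.Qb VX t)⟫_ℝ)) =O[𝓝 0] fun γ => γ ^ 2 := by
  have hvar : A.IsVariation t₀ tf (A.δUd VX VXX δX) (A.δUb VX VXX δX) δX := hδX
  have hlim := hwp.tendsto_pathNorm_sub hud hub hd hb hx hy
  obtain ⟨hlin, hquad⟩ := hvar.linearisation_isBigO h₀ hL hS hx hy hlim
  have hJ := hC.total_sub_isBigO hA h₀ hx.1.isPath hvar.1.isPath hd hb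
    (fun γ => (hy γ).1.isPath) hlin hquad
  simpa only [hδX.costVariation_eq hA h₀ hVX hd hb, mul_neg, sub_neg_eq_add] using hJ

end Descent

end STDDP

open STDDP in
theorem mainTheorem1_general {d n k l : ℕ} (D Γ : Set (Euc d)) (t₀ tf : ℝ) (h₀ : t₀ ≤ tf)
    (sys : System D Γ n k l) (C : Cost D n k l) (hwp : sys.WellPosed t₀ tf) (X₀ : L2D D n)
    (𝒳 : (ℝ → L2D D k) → (ℝ → L2S D l) → Path D Γ n)
    (h𝒳 : ∀ (ud : ℝ → L2D D k) (ub : ℝ → L2S D l), MemLp ud 2 (timeMeasure t₀ tf) →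
      MemLp ub 2 (timeMeasure t₀ tf) → sys.IsSolution t₀ tf X₀ ud ub (𝒳 ud ub))
    (Ud : ℝ → L2D D k) (Ub : ℝ → L2S D l)
    (hUd : MemLp Ud 2 (timeMeasure t₀ tf)) (hUb : MemLp Ub 2 (timeMeasure t₀ tf))
    (A : Derivs D Γ n k l)
    (_ : A.OfSystem sys t₀ tf (𝒳 Ud Ub) Ud Ub) (_ : A.OfCost C t₀ tf (𝒳 Ud Ub) Ud Ub)
    (hAr : A.Regular t₀ tf) (hAwp : A.VariationWellPosed t₀ tf)
    (VX δX : Path D Γ n) (VXX : OpPath D Γ n)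
    (hVX : A.BackwardFirst t₀ tf VX VXX) (hδX : A.Variation t₀ tf VX VXX δX)
    (hδUd : MemLp (A.δUd VX VXX δX) 2 (timeMeasure t₀ tf))
    (hδUb : MemLp (A.δUb VX VXX δX) 2 (timeMeasure t₀ tf))
    (hQ : MemLp (A.QU VX) 2 (timeMeasure t₀ tf))
    (hES : A.SystemExpansion sys t₀ tf (𝒳 Ud Ub) Ud (A.δUd VX VXX δX) Ub (A.δUb VX VXX δX))
    (hEC : A.CostExpansion C t₀ tf (𝒳 Ud Ub) Ud (A.δUd VX VXX δX) Ub (A.δUb VX VXX δX)) :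
    let J : ℝ → ℝ := fun γ =>
      C.total t₀ tf (𝒳 (Ud + γ • A.δUd VX VXX δX) (Ub + γ • A.δUb VX VXX δX))
        (Ud + γ • A.δUd VX VXX δX) (Ub + γ • A.δUb VX VXX δX)
    ∃ (M : Lp (Ctrl D k l) 2 (timeMeasure t₀ tf) →L[ℝ] Lp (Ctrl D k l) 2 (timeMeasure t₀ tf))
      (m : ℝ → Ctrl D k l →L[ℝ] Ctrl D k l),
      (∀ u : Lp (Ctrl D k l) 2 (timeMeasure t₀ tf),
        ∀ᵐ t ∂timeMeasure t₀ tf, M u t = m t (u t)) ∧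
      (∀ t ∈ Set.Icc t₀ tf, ∀ (u : L2D D k) (b : L2S D l),
        m t (WithLp.toLp 2 (A.LUdUd t u, A.LUbUb t b)) = WithLp.toLp 2 (u, b)) ∧
      (∀ t ∈ Set.Icc t₀ tf, ∀ u v, ⟪m t u, v⟫_ℝ = ⟪u, m t v⟫_ℝ) ∧
      (∃ c > 0, ∀ t ∈ Set.Icc t₀ tf, ∀ u, c * ‖u‖ ^ 2 ≤ ⟪u, m t u⟫_ℝ) ∧
      (∃ ρ : ℝ → ℝ, ρ =O[𝓝 0] (fun γ => γ ^ 2) ∧ ∀ γ : ℝ,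
        HasDerivAt (fun i : ℝ => J (i * γ))
          (-γ * ⟪hQ.toLp (A.QU VX), M (hQ.toLp (A.QU VX))⟫_ℝ + ρ γ) 0) ∧
      (fun γ => J γ - J 0 + γ * ⟪hQ.toLp (A.QU VX), M (hQ.toLp (A.QU VX))⟫_ℝ)
        =O[𝓝 0] (fun γ => γ ^ 2) ∧
      (hQ.toLp (A.QU VX) ≠ 0 → ∀ᶠ γ in 𝓝[>] (0 : ℝ), J γ < J 0) := by
  intro J
  obtain ⟨M, hM⟩ := hAr.exists_Lp_inverse_LUU
  have hy (γ : ℝ) := h𝒳 _ _ (hUd.add (hδUd.const_smul γ)) (hUb.add (hδUb.const_smul γ))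
  have hJ : (fun γ => J γ - J 0 + γ * ⟪hQ.toLp (A.QU VX), M (hQ.toLp (A.QU VX))⟫_ℝ)
      =O[𝓝 0] (fun γ => γ ^ 2) := by
    simpa only [J, zero_smul, add_zero, hAr.inner_QU_eq_integral h₀ hQ hM] using
      hwp.total_update_isBigO h₀ hAr hAwp hUd hUb (h𝒳 Ud Ub hUd hUb) hVX hδX hδUd hδUb hES hEC hy
  refine ⟨M, fun t => Ring.inverse (A.LUU t), hM,
    fun t ht u b => inverse_apply_apply (hAr.isUnit_LUU ht) (WithLp.toLp 2 (u, b)),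
    fun t ht => hAr.inverse_LUU_symm ht, hAr.exists_coercive_inverse_LUU,
    ⟨0, Asymptotics.isBigO_zero _ _, fun γ => ?_⟩, hJ,
    fun hne => eventually_lt_of_isBigO_sq (hAr.inner_Lp_inverse_LUU_pos hM hne) hJ⟩
  simpa using hasDerivAt_comp_mul_const_of_isBigO_sq hJ γ

open STDDP in
theorem mainTheorem1 {d n k l : ℕ} (D Γ : Set (Euc d)) (hDo : IsOpen D) (hDc : IsConnected D)
    (hΓ : MeasurableSet Γ) (hΓS : Γ ⊆ frontier D)
    (t₀ tf : ℝ) (ht : t₀ < tf)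
    (sys : System D Γ n k l) (C : Cost D n k l) (hwp : sys.WellPosed t₀ tf) (X₀ : L2D D n)
    -- the control-to-state map
    (𝒳 : (ℝ → L2D D k) → (ℝ → L2S D l) → Path D Γ n)
    (h𝒳 : ∀ (ud : ℝ → L2D D k) (ub : ℝ → L2S D l), MemLp ud 2 (timeMeasure t₀ tf) →
      MemLp ub 2 (timeMeasure t₀ tf) → sys.IsSolution t₀ tf X₀ ud ub (𝒳 ud ub))
    -- the nominal controls, and the derivatives along the nominal trajectory
    (Ud : ℝ → L2D D k) (Ub : ℝ → L2S D l)
    (hUd : MemLp Ud 2 (timeMeasure t₀ tf)) (hUb : MemLp Ub 2 (timeMeasure t₀ tf))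
    (A : Derivs D Γ n k l)
    (hAS : A.OfSystem sys t₀ tf (𝒳 Ud Ub) Ud Ub) (hAC : A.OfCost C t₀ tf (𝒳 Ud Ub) Ud Ub)
    (hAr : A.Regular t₀ tf) (hAwp : A.VariationWellPosed t₀ tf)
    -- the STDDP sweep
    (VX δX : Path D Γ n) (VXX : OpPath D Γ n)
    (hVX : A.BackwardFirst t₀ tf VX VXX) (hVXX : A.BackwardSecond t₀ tf VXX)
    (hδX : A.Variation t₀ tf VX VXX δX)
    (hδUd : MemLp (A.δUd VX VXX δX) 2 (timeMeasure t₀ tf))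
    (hδUb : MemLp (A.δUb VX VXX δX) 2 (timeMeasure t₀ tf))
    (hQ : MemLp (A.QU VX) 2 (timeMeasure t₀ tf))
    -- the remainders of the expansions around the nominal trajectory
    (hES : A.SystemExpansion sys t₀ tf (𝒳 Ud Ub) Ud (A.δUd VX VXX δX) Ub (A.δUb VX VXX δX))
    (hEC : A.CostExpansion C t₀ tf (𝒳 Ud Ub) Ud (A.δUd VX VXX δX) Ub (A.δUb VX VXX δX)) :
    let J : ℝ → ℝ := fun γ =>
      C.total t₀ tf (𝒳 (Ud + γ • A.δUd VX VXX δX) (Ub + γ • A.δUb VX VXX δX))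
        (Ud + γ • A.δUd VX VXX δX) (Ub + γ • A.δUb VX VXX δX)
    ∃ (M : Lp (Ctrl D k l) 2 (timeMeasure t₀ tf) →L[ℝ] Lp (Ctrl D k l) 2 (timeMeasure t₀ tf))
      (m : ℝ → Ctrl D k l →L[ℝ] Ctrl D k l),
      -- `M` acts at each time by the operator `m t`, which is the inverse of `L_UU`
      (∀ u : Lp (Ctrl D k l) 2 (timeMeasure t₀ tf),
        ∀ᵐ t ∂timeMeasure t₀ tf, M u t = m t (u t)) ∧
      (∀ t ∈ Set.Icc t₀ tf, ∀ (u : L2D D k) (b : L2S D l),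
        m t (WithLp.toLp 2 (A.LUdUd t u, A.LUbUb t b)) = WithLp.toLp 2 (u, b)) ∧
      -- symmetric and (uniformly) positive definite for every `t`
      (∀ t ∈ Set.Icc t₀ tf, ∀ u v, ⟪m t u, v⟫_ℝ = ⟪u, m t v⟫_ℝ) ∧
      (∃ c > 0, ∀ t ∈ Set.Icc t₀ tf, ∀ u, c * ‖u‖ ^ 2 ≤ ⟪u, m t u⟫_ℝ) ∧
      -- along `dU/di = γ δU`, the derivative of the cost with respect to the iteration index `i`
      (∃ ρ : ℝ → ℝ, ρ =O[𝓝 0] (fun γ => γ ^ 2) ∧ ∀ γ : ℝ,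
        HasDerivAt (fun i : ℝ => J (i * γ))
          (-γ * ⟪hQ.toLp (A.QU VX), M (hQ.toLp (A.QU VX))⟫_ℝ + ρ γ) 0) ∧
      -- the change of the cost over one iteration with step size `γ`
      (fun γ => J γ - J 0 + γ * ⟪hQ.toLp (A.QU VX), M (hQ.toLp (A.QU VX))⟫_ℝ)
        =O[𝓝 0] (fun γ => γ ^ 2) ∧
      -- first order descent
      (hQ.toLp (A.QU VX) ≠ 0 → ∀ᶠ γ in 𝓝[>] (0 : ℝ), J γ < J 0) :=
  mainTheorem1_general D Γ t₀ tf ht.le sys C hwp X₀ 𝒳 h𝒳 Ud Ub hUd hUb A hAS hAC hAr hAwp VX δX VXX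
    hVX hδX hδUd hδUb hQ hES hEC
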